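/- Let $\mathcal R$ be an o-minimal expansion of a real closed field $R$ (an expansion of the ordered field $R$ in which every subset of $R$ definable with parameters is a finite union of points and open intervals with endpoints in $R\cup\{\pm\infty\}$). Equip $R$ with the order topology and $R^n$ with the product topology, let $X\subseteq R^n$ be definable (with parameters), and give $X$ the subspace topology. Let $\mathcal C^{\mathcal R}(X)$ be the ring of continuous definable functions $f:X\to R$, and write $Z(f)=f^{-1}(0)$. Let $\mathrm{Spec}_X(\mathcal R)$ be the set of complete $n$-types over $R$ that contain $X$ (a definable set is identified with the formulas that define it), with the topology whose basic open sets are $[U]=\{p : U\in p\}$ for $U\subseteq X$ definable and open in $X$. Let $\beta_X(\mathcal R)\subseteq \mathrm{Spec}_X(\mathcal R)$ be the subspace of closed points. Let $\mathrm{Spec}(\mathcal C^{\mathcal R}(X))$ be the prime spectrum with the Zariski topology and $\mathrm{Max}(\mathcal C^{\mathcal R}(X))$ its subspace of maximal ideals. Let $$\iota:\mathrm{Spec}_X(\mathcal R)\to \mathrm{Spec}(\mathcal C^{\mathcal R}(X)),\qquad \iota(p)=\{f\in\mathcal C^{\mathcal R}(X) : Z(f)\in p\}.$$ Theorem. The map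 $\iota$ restricts to a homeomorphism $\iota|_{\beta_X(\mathcal R)}:\beta_X(\mathcal R)\to \mathrm{Max}(\mathcal C^{\mathcal R}(X))$. Moreover, there are continuous retractions $r:\mathrm{Spec}_X(\mathcal R)\to\beta_X(\mathcal R)$ and $r_{\mathrm{Spec}}:\mathrm{Spec}(\mathcal C^{\mathcal R}(X))\to\mathrm{Max}(\mathcal C^{\mathcal R}(X))$, where $r(p)$ is the unique closed point in the closure of $\{p\}$ and $r_{\mathrm{Spec}}(\mathfrak p)$ is the unique closed point in the closure of $\{\mathfrak p\}$ (that is, the unique maximal ideal containing $\mathfrak p$), and $$\iota|_{\beta_X(\mathcal R)}\circ r = r_{\mathrm{Spec}}\circ\iota .$$ -/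

import Mathlib

universe u v w

namespace OMin

open FirstOrder Set

section Structures

variable (L : FirstOrder.Language.{u, v}) (R : Type w) [L.Structure R]

/-- `R`, with its `L`-structure, expands the ordered field `R`: the order and the graphs of
addition and multiplication are definable (this holds in particular when `L` has symbols
interpreted by the order and the field operations of `R`). -/
class ExpandsOrderedField [Field R] [LinearOrder R] : Prop where
  definable_lt : (univ : Set R).Definable L {x : Fin 2 → R | x 0 < x 1}
  definable_add : (univ : Set R).Definable L {x : Fin 3 → R | x 0 + x 1 = x 2}
  definable_mul : (univ : Set R).Definable L {x : Fin 3 → R | x 0 * x 1 = x 2}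

/-- A point, or an open interval with endpoints in `R ∪ {-∞, +∞}`. -/
def IsPointOrInterval {R : Type w} [LinearOrder R] (I : Set R) : Prop :=
  (∃ a, I = {a}) ∨ (∃ a b, I = Ioo a b) ∨ (∃ a, I = Iio a) ∨ (∃ a, I = Ioi a) ∨ I = univ

/-- O-minimality: every subset of `R` definable with parameters is a finite union of points and
open intervals. -/
class IsOMinimal [LinearOrder R] : Prop where
  finite_union : ∀ S : Set R, (univ : Set R).Definable₁ L S →
    ∃ F : Set (Set R), F.Finite ∧ (∀ I ∈ F, IsPointOrInterval I) ∧ S = ⋃₀ F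

/-- The sets `X ⊆ R ^ n` definable with parameters from `R`. -/
abbrev DefSet (n : ℕ) := L.DefinableSet (univ : Set R) (Fin n)

/-- The complete `n`-types over `R`: complete types in `n` variables of the theory of `R` in the
language with a constant for every element of `R`. -/
abbrev TypeOver (n : ℕ) := (L[[(univ : Set R)]].completeTheory R).CompleteType (Fin n)

end Structures

section Types

variable {L : FirstOrder.Language.{u, v}} {R : Type w} [L.Structure R] {n : ℕ}

/-- The definable set `V` belongs to the type `p`: some formula with parameters which defines `V`
is in `p` (equivalently all such formulas are). -/
def MemType (V : DefSet L R n) (p : TypeOver L R n) : Prop :=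
  ∃ φ : L[[(univ : Set R)]].Formula (Fin n),
    (V : Set (Fin n → R)) = {x | φ.Realize x} ∧ FirstOrder.Language.Formula.equivSentence φ ∈ p

theorem formula_mem_of_imp [Nonempty R] (p : TypeOver L R n)
    {φ ψ θ : L[[(univ : Set R)]].Formula (Fin n)}
    (h : ∀ x : Fin n → R, φ.Realize x → ψ.Realize x → θ.Realize x)
    (hφ : FirstOrder.Language.Formula.equivSentence φ ∈ p) (hψ : FirstOrder.Language.Formula.equivSentence ψ ∈ p) :
    FirstOrder.Language.Formula.equivSentence θ ∈ p := by
  obtain ⟨N, a, rfl⟩ := FirstOrder.Language.Theory.exists_modelType_is_realized_in _ p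
  rw [FirstOrder.Language.Theory.CompleteType.formula_mem_typeOf] at hφ hψ ⊢
  let χ : L[[(univ : Set R)]].Sentence :=
    FirstOrder.Language.Formula.iAlls (α := Empty) (Fin n) ((φ.imp (ψ.imp θ)).relabel Sum.inr)
  have hχ : χ ∈ L[[(univ : Set R)]].completeTheory R := by
    rw [FirstOrder.Language.mem_completeTheory]
    simp only [χ, FirstOrder.Language.Sentence.Realize, FirstOrder.Language.Formula.realize_iAlls,
      FirstOrder.Language.Formula.realize_relabel, FirstOrder.Language.Formula.realize_imp]
    intro x
    exact h _
  have hN : N ⊨ χ := FirstOrder.Language.Theory.realize_sentence_of_mem _ hχ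
  simp only [χ, FirstOrder.Language.Sentence.Realize, FirstOrder.Language.Formula.realize_iAlls,
      FirstOrder.Language.Formula.realize_relabel, FirstOrder.Language.Formula.realize_imp] at hN
  exact hN a hφ hψ

theorem memType_of_inf_le [Nonempty R] {p : TypeOver L R n} {V W T : DefSet L R n}
    (hV : MemType V p) (hW : MemType W p) (h : V ⊓ W ≤ T) : MemType T p := by
  obtain ⟨φ, hφ, hφp⟩ := hV
  obtain ⟨ψ, hψ, hψp⟩ := hW
  obtain ⟨θ, hθ⟩ := T.2
  refine ⟨θ, hθ, formula_mem_of_imp p (fun x h1 h2 => ?_) hφp hψp⟩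
  have hx : x ∈ (T : Set (Fin n → R)) := by
    apply h
    have h1' : x ∈ (V : Set (Fin n → R)) := by rw [hφ]; exact h1
    have h2' : x ∈ (W : Set (Fin n → R)) := by rw [hψ]; exact h2
    exact ⟨h1', h2'⟩
  have hθ' : (T : Set (Fin n → R)) = {x | θ.Realize x} := hθ
  rw [hθ'] at hx
  exact hx

theorem memType_mono [Nonempty R] {p : TypeOver L R n} {V T : DefSet L R n}
    (hV : MemType V p) (h : V ≤ T) : MemType T p :=
  memType_of_inf_le hV hV (inf_le_left.trans h)

theorem not_memType_bot [Nonempty R] (p : TypeOver L R n) : ¬ MemType (⊥ : DefSet L R n) p := by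
  rintro ⟨φ, hφ, hp⟩
  have h0 : ∀ x : Fin n → R, ¬ φ.Realize x := by
    intro x hx
    have : x ∈ ((⊥ : DefSet L R n) : Set (Fin n → R)) := by rw [hφ]; exact hx
    exact this
  have := formula_mem_of_imp p (θ := φ.not) (fun x hx _ => (h0 x hx).elim) hp hp
  rw [FirstOrder.Language.Formula.equivSentence_not, FirstOrder.Language.Theory.CompleteType.not_mem_iff] at this
  exact this hp

theorem memType_compl_of_not {p : TypeOver L R n} {V : DefSet L R n}
    (h : ¬ MemType V p) : MemType Vᶜ p := by
  obtain ⟨φ, hφ⟩ := V.2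
  have hφ' : (V : Set (Fin n → R)) = {x | φ.Realize x} := hφ
  refine ⟨φ.not, ?_, ?_⟩
  · ext x
    have : x ∈ V ↔ φ.Realize x := by rw [← SetLike.mem_coe, hφ']; rfl
    simp [this]
  · rw [FirstOrder.Language.Formula.equivSentence_not, FirstOrder.Language.Theory.CompleteType.not_mem_iff]
    exact fun hp => h ⟨φ, hφ, hp⟩

theorem memType_or_of_le_sup [Nonempty R] {p : TypeOver L R n} {T V W : DefSet L R n}
    (hT : MemType T p) (h : T ≤ V ⊔ W) : MemType V p ∨ MemType W p := by
  by_contra! hc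
  refine not_memType_bot p (memType_of_inf_le hT
    (memType_of_inf_le (memType_compl_of_not hc.1) (memType_compl_of_not hc.2) le_rfl) ?_)
  rintro x ⟨hxT, hxV, hxW⟩
  rcases h hxT with hx | hx
  · exact (hxV hx).elim
  · exact (hxW hx).elim

/-- The space `Spec_X(R)`: the set of complete types over `R` that concentrate on `X`. -/
structure OMinSpectrum (X : DefSet L R n) where
  toType : TypeOver L R n
  mem : MemType X toType

/-- The spectral topology on `Spec_X(R)`: the sets `[U]`, for `U ⊆ X` definable and open in `X`,
are a basis of open sets (they are stable under finite intersections). -/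
instance [TopologicalSpace R] (X : DefSet L R n) : TopologicalSpace (OMinSpectrum X) :=
  TopologicalSpace.generateFrom
    {B | ∃ U : DefSet L R n, U ≤ X ∧ (∃ O : Set (Fin n → R), IsOpen O ∧
      (U : Set (Fin n → R)) = O ∩ X) ∧ B = {p | MemType U p.toType}}

/-- The set of closed points of a topological space, with the subspace topology. -/
abbrev ClosedPoints (S : Type*) [TopologicalSpace S] := {p : S // IsClosed ({p} : Set S)}

end Types

section Functions

variable {L : FirstOrder.Language.{u, v}} {R : Type w} [L.Structure R] {n : ℕ}

/-- A function `f : X → R` is definable (with parameters) if its graph is. -/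
def IsDefinableFun (X : DefSet L R n) (f : X → R) : Prop :=
  (univ : Set R).Definable L
    {y : Fin (n + 1) → R | ∃ h : Fin.init y ∈ X, f ⟨Fin.init y, h⟩ = y (Fin.last n)}

theorem isDefinableFun_const (X : DefSet L R n) (c : R) : IsDefinableFun X fun _ => c := by
  unfold IsDefinableFun
  have h1 := X.2.preimage_comp (Fin.castSucc : Fin n → Fin (n + 1))
  have h2 : (univ : Set R).Definable L {y : Fin 1 → R | y 0 ∈ ({c} : Set R)} :=
    Definable.singleton_of_mem L (mem_univ c)
  convert h1.inter (h2.preimage_comp (fun _ : Fin 1 => Fin.last n)) using 1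
  ext y
  simp only [exists_prop, mem_inter_iff, mem_preimage, mem_ofPred_eq, mem_singleton_iff,
    Function.comp_apply]
  exact and_congr Iff.rfl eq_comm

theorem IsDefinableFun.binop {X : DefSet L R n} {op : R → R → R}
    (hop : (univ : Set R).Definable L {x : Fin 3 → R | op (x 0) (x 1) = x 2})
    {f g : X → R} (hf : IsDefinableFun X f) (hg : IsDefinableFun X g) :
    IsDefinableFun X fun x => op (f x) (g x) := by
  unfold IsDefinableFun
  let σ : Fin 2 → Fin (n + 1) → Fin (n + 1) ⊕ Fin 2 := fun c =>
    Fin.snoc (α := fun _ => Fin (n + 1) ⊕ Fin 2) (fun i => Sum.inl i.castSucc) (Sum.inr c)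
  let τ : Fin 3 → Fin (n + 1) ⊕ Fin 2 := ![Sum.inr 0, Sum.inr 1, Sum.inl (Fin.last n)]
  have key := ((hf.preimage_comp (σ 0)).inter
    ((hg.preimage_comp (σ 1)).inter (hop.preimage_comp τ))).exists_of_finite
  have hσi : ∀ (c : Fin 2) (y : Fin (n + 1) → R) (z : Fin 2 → R),
      Fin.init (α := fun _ => R) (Sum.elim y z ∘ σ c) = Fin.init (α := fun _ => R) y := by
    intro c y z
    funext i
    simp [Fin.init, σ]
  have hσl : ∀ (c : Fin 2) (y : Fin (n + 1) → R) (z : Fin 2 → R),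
      (Sum.elim y z ∘ σ c) (Fin.last n) = z c := by
    intro c y z
    simp [σ]
  convert key using 1
  ext y
  simp only [mem_inter_iff, mem_preimage, mem_ofPred_eq, hσi, hσl]
  constructor
  · rintro ⟨h, hy⟩
    exact ⟨![f ⟨_, h⟩, g ⟨_, h⟩], ⟨h, rfl⟩, ⟨h, rfl⟩, by simpa [τ] using hy⟩
  · rintro ⟨z, ⟨h, h1⟩, ⟨_, h2⟩, h3⟩
    refine ⟨h, ?_⟩
    rw [h1, h2]
    simpa [τ] using h3

variable [Field R] [LinearOrder R] [IsStrictOrderedRing R] [TopologicalSpace R] [OrderTopology R]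
  [ExpandsOrderedField L R]

/-- The ring of continuous definable functions `X → R`. -/
def definableContinuous (X : DefSet L R n) : Subring C(X, R) where
  carrier := {f | IsDefinableFun X f}
  zero_mem' := isDefinableFun_const X 0
  one_mem' := isDefinableFun_const X 1
  add_mem' hf hg := IsDefinableFun.binop (ExpandsOrderedField.definable_add (L := L)) hf hg
  mul_mem' hf hg := IsDefinableFun.binop (ExpandsOrderedField.definable_mul (L := L)) hf hg
  neg_mem' {f} hf := by
    have := IsDefinableFun.binop (ExpandsOrderedField.definable_mul (L := L))
      (isDefinableFun_const X (-1)) hf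
    simpa [IsDefinableFun] using this

/-- The zero set `Z(f) ⊆ X` of a continuous definable function, as a definable set. -/
def zeroSet {X : DefSet L R n} (f : definableContinuous X) : DefSet L R n where
  val := {x | ∃ h : x ∈ X, f.1 ⟨x, h⟩ = 0}
  property := by
    have hf : IsDefinableFun X f.1 := f.2
    have h0 : (univ : Set R).Definable L {y : Fin 1 → R | y 0 ∈ ({0} : Set R)} :=
      Definable.singleton_of_mem L (mem_univ 0)
    convert (hf.inter (h0.preimage_comp (fun _ : Fin 1 => Fin.last n))).image_comp
      (Fin.castSucc : Fin n → Fin (n + 1)) using 1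
    ext x
    constructor
    · rintro ⟨h, hx⟩
      refine ⟨Fin.snoc (α := fun _ => R) x 0, ⟨?_, ?_⟩, ?_⟩
      · simp [h, hx]
      · simp
      · funext i
        simp
    · rintro ⟨y, ⟨⟨h, hy⟩, h2⟩, rfl⟩
      refine ⟨h, hy.trans ?_⟩
      simpa using h2

theorem mem_zeroSet {X : DefSet L R n} (f : definableContinuous X) (x : Fin n → R) :
    x ∈ zeroSet f ↔ ∃ h : x ∈ X, f.1 ⟨x, h⟩ = 0 := Iff.rfl

/-- The map `ι : Spec_X(R) → Spec(C^R(X))`, `p ↦ {f | Z(f) ∈ p}`. -/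
def iota (X : DefSet L R n) (p : OMinSpectrum X) : PrimeSpectrum (definableContinuous X) where
  asIdeal :=
    { carrier := {f | MemType (zeroSet f) p.toType}
      zero_mem' := memType_mono p.mem fun x hx => (mem_zeroSet _ x).2 ⟨hx, rfl⟩
      add_mem' := fun {f g} hf hg => memType_of_inf_le hf hg (by
        rintro x ⟨⟨h, h1⟩, ⟨_, h2⟩⟩
        exact ⟨h, by simp [h1, h2]⟩)
      smul_mem' := fun g f hf => memType_mono hf (by
        rintro x ⟨h, h1⟩
        exact ⟨h, by simp [h1]⟩) }
  isPrime := by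
    constructor
    · rw [Ideal.ne_top_iff_one]
      intro h
      refine not_memType_bot p.toType (memType_mono h ?_)
      rintro x ⟨_, h1⟩
      exact absurd h1 (by simp)
    · intro f g hfg
      refine memType_or_of_le_sup hfg ?_
      rintro x ⟨h, h1⟩
      rcases mul_eq_zero.1 h1 with h2 | h2
      · exact Or.inl ⟨h, h2⟩
      · exact Or.inr ⟨h, h2⟩

end Functions

/-- Let `i : T → S` be the inclusion of the closed points of `S`. Then `r : S → T` is the
retraction onto the closed points: it is continuous, restricts to the identity on `T`, and `r x` is
the unique closed point in the closure of `x`. -/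
structure IsClosedPointRetraction {S T : Type*} [TopologicalSpace S] [TopologicalSpace T]
    (i : T → S) (r : S → T) : Prop where
  continuous : Continuous r
  leftInverse : Function.LeftInverse r i
  mem_closure_iff : ∀ x m, i m ∈ closure {x} ↔ m = r x

end OMin

/-! The whole statement is pulled back from the prime spectrum along `iota`, which is shown to be a
topological embedding whose image contains every maximal ideal.

The topology is the easy half. The truncated sup-norm distance to a definable set is definable and
continuous, so the definable relatively closed subsets of `X` are exactly the zero sets
(`exists_zero_iff_cl`), and the basic open sets on the two sides correspond (`isInducing_iota`). A
maximal ideal is hit because finitely many of its members have a common zero: the sum of their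
squares is not a unit. Compactness then yields a type containing all the zero sets
(`exists_iota_eq`).

Injectivity is the substantial half: a type is determined by the closed definable sets it contains
(`eq_of_holds_closed_iff`). No cell decomposition is used. A Baire-like property of definable sets,
proved by induction on dimension (`baireProperty`), provides smallness: finite unions and increasing
definable unions of sets without interior have no interior. Project to a maximal family of
coordinates in which the type is generic. Any definable set in the type shrinks to a member `W`
whose closure has finite fibres over the complement of a small closed set, and `W` is then
relatively closed off another small closed set (`not_hasInt_image_frontier`). Thus membership in the
type is witnessed by closed sets and complements of closed sets.

Finally, the ring is Gelfand, since if `f + g = 1` the positive parts of `f² - g²` and `g² - f²`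
have product zero. Hence each prime lies in a unique maximal ideal and this assignment is
continuous. Transporting it through `iota` gives the retraction on types. -/

namespace OMin

open FirstOrder Set Topology

set_option linter.unusedSectionVars false

/-! ### A calculus of definable predicates and maps on finite powers of `R`. -/

section Definability

/-- `T` is, via fixed coordinates, a finite power of `R`. -/
class Coordinatized (R : Type w) (T : Type*) where
  idx : Type
  finite_idx : Finite idx
  coord : T ≃ (idx → R)

attribute [instance] Coordinatized.finite_idx

open Coordinatized

instance Coordinatized.self (R : Type w) : Coordinatized R R where
  idx := Unit
  finite_idx := inferInstance
  coord := (Equiv.funUnique Unit R).symm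

instance Coordinatized.pi (R : Type w) (α : Type) [Finite α] : Coordinatized R (α → R) where
  idx := α
  finite_idx := inferInstance
  coord := Equiv.refl _

instance Coordinatized.prod (R : Type w) (T T' : Type*) [Coordinatized R T] [Coordinatized R T'] :
    Coordinatized R (T × T') where
  idx := idx R T ⊕ idx R T'
  finite_idx := inferInstance
  coord := ((coord (R := R)).prodCongr (coord (R := R))).trans (Equiv.sumArrowEquivProdArrow _ _ _).symm

variable (L : FirstOrder.Language.{u, v}) {R : Type w} [L.Structure R]
  {T T' T'' : Type*} [Coordinatized R T] [Coordinatized R T'] [Coordinatized R T'']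

/-- A predicate on a power of `R` is definable with parameters. -/
def DefPred (R : Type w) [L.Structure R] {T : Type*} [Coordinatized R T] (P : T → Prop) : Prop :=
  (univ : Set R).Definable L {v : idx R T → R | P (coord.symm v)}

/-- A map between powers of `R` is definable with parameters. -/
@[fun_prop]
def DefMap (R : Type w) [L.Structure R] {T T' : Type*} [Coordinatized R T] [Coordinatized R T']
    (f : T → T') : Prop :=
  (univ : Set R).DefinableMap L fun v : idx R T → R => coord (R := R) (f (coord.symm v))

variable {L}

theorem DefPred.of_iff {P Q : T → Prop} (hP : DefPred L R P) (h : ∀ x, Q x ↔ P x) :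
    DefPred L R Q := by
  rwa [show Q = P from funext fun x => propext (h x)]

theorem DefPred.const (p : Prop) : DefPred L R fun _ : T => p := by
  by_cases h : p
  · simp [DefPred, h]
  · simp [DefPred, h]

theorem DefPred.and {P Q : T → Prop} (hP : DefPred L R P) (hQ : DefPred L R Q) :
    DefPred L R fun x => P x ∧ Q x := Definable.inter hP hQ

theorem DefPred.or {P Q : T → Prop} (hP : DefPred L R P) (hQ : DefPred L R Q) :
    DefPred L R fun x => P x ∨ Q x := Definable.union hP hQ

theorem DefPred.not {P : T → Prop} (hP : DefPred L R P) :
    DefPred L R fun x => ¬ P x := Definable.compl hP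

theorem DefPred.imp {P Q : T → Prop} (hP : DefPred L R P) (hQ : DefPred L R Q) :
    DefPred L R fun x => P x → Q x :=
  (hP.not.or hQ).of_iff fun _ => imp_iff_not_or

theorem DefPred.iff {P Q : T → Prop} (hP : DefPred L R P) (hQ : DefPred L R Q) :
    DefPred L R fun x => P x ↔ Q x :=
  ((hP.imp hQ).and (hQ.imp hP)).of_iff fun _ => iff_iff_implies_and_implies

theorem DefPred.ex {P : T → T' → Prop} (hP : DefPred L R fun p : T × T' => P p.1 p.2) :
    DefPred L R fun x => ∃ y, P x y := by
  unfold DefPred at hP ⊢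
  convert Definable.exists_of_finite hP using 1
  ext v
  refine (coord (R := R) (T := T')).exists_congr fun y => ?_
  change _ ↔ P (coord.symm (Sum.elim v _ ∘ Sum.inl)) (coord.symm (Sum.elim v _ ∘ Sum.inr))
  simp

theorem DefPred.all {P : T → T' → Prop} (hP : DefPred L R fun p : T × T' => P p.1 p.2) :
    DefPred L R fun x => ∀ y, P x y :=
  (DefPred.ex (P := fun x y => ¬ P x y) hP.not).not.of_iff fun x => by simp

theorem DefPred.finite_all {ι : Type*} [Finite ι] {P : ι → T → Prop}
    (hP : ∀ i, DefPred L R (P i)) : DefPred L R fun x => ∀ i, P i x := by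
  unfold DefPred at hP ⊢
  simpa only [ofPred_forall] using definable_iInter_of_finite hP

theorem DefPred.finite_ex {ι : Type*} [Finite ι] {P : ι → T → Prop}
    (hP : ∀ i, DefPred L R (P i)) : DefPred L R fun x => ∃ i, P i x :=
  (DefPred.finite_all fun i => (hP i).not).not.of_iff fun x => by simp

theorem DefPred.comp {P : T' → Prop} {f : T → T'} (hP : DefPred L R P) (hf : DefMap L R f) :
    DefPred L R fun x => P (f x) := by
  have := Definable.preimage_map hf hP
  unfold DefPred
  convert this using 1
  ext v
  simp

@[fun_prop]
theorem DefMap.id : DefMap L R (fun x : T => x) := by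
  intro i
  simp only [Equiv.apply_symm_apply]
  fun_prop

@[fun_prop]
theorem DefMap.const (c : T') : DefMap L R (fun _ : T => c) := fun _ =>
  L.definableFun_const _ (mem_univ _)

@[fun_prop]
theorem DefMap.comp {f : T' → T''} {g : T → T'} (hf : DefMap L R f) (hg : DefMap L R g) :
    DefMap L R fun x => f (g x) := by
  intro i
  have := DefinableFun.comp hg (hf i)
  simpa using this

@[fun_prop]
theorem DefMap.prodMk {f : T → T'} {g : T → T''} (hf : DefMap L R f) (hg : DefMap L R g) :
    DefMap L R fun x => (f x, g x) := by
  rintro (i | i)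
  · exact hf i
  · exact hg i

@[fun_prop]
theorem DefMap.fst {f : T → T' × T''} (hf : DefMap L R f) : DefMap L R fun x => (f x).1 :=
  fun i => hf (Sum.inl i)

@[fun_prop]
theorem DefMap.snd {f : T → T' × T''} (hf : DefMap L R f) : DefMap L R fun x => (f x).2 :=
  fun i => hf (Sum.inr i)

@[fun_prop]
theorem DefMap.pi {α : Type} [Finite α] {f : T → α → R} (hf : ∀ i, DefMap L R fun x => f x i) :
    DefMap L R f := fun i => hf i ()

@[fun_prop]
theorem DefMap.eval {α : Type} [Finite α] (i : α) :
    DefMap L R fun z : α → R => z i := fun _ => DefinableFun.proj (α := α) L (A := univ) (i := i)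

theorem DefPred.eq {f g : T → T'} (hf : DefMap L R f) (hg : DefMap L R g) :
    DefPred L R fun x => f x = g x := by
  have := DefPred.finite_all (L := L) (R := R) (T := T)
    (P := fun i x => coord (R := R) (f x) i = coord (R := R) (g x) i) fun i => by
      have h := hf i; have h' := hg i
      rw [DefinableFun] at h h'
      have hF : (univ : Set R).DefinableMap L
        (fun v : idx R T → R => ![coord (R := R) (f (coord.symm v)) i,
          coord (R := R) (g (coord.symm v)) i]) := by
        intro j
        fin_cases j
        · exact hf i
        · exact hg i
      exact (Definable.diagonal L univ).preimage_map hF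
  exact this.of_iff fun x => by
    rw [← funext_iff, EmbeddingLike.apply_eq_iff_eq]

theorem DefMap.of_graph {f : T → T'} (hf : DefPred L R fun p : T × T' => f p.1 = p.2) :
    DefMap L R f := by
  intro i
  -- The variable indexed by `none` carries the value of the `i`-th coordinate; those indexed by
  -- `some` carry the argument.
  have h := DefPred.ex (L := L) (R := R) (T := (Option (idx R T) → R)) (T' := T')
    (P := fun v y => f (coord.symm (v ∘ some)) = y ∧ coord (R := R) y i = v none) (by
      refine .and (hf.comp (f := fun p : (Option (idx R T) → R) × T' =>
        ((coord (R := R)).symm (p.1 ∘ some), p.2)) ?_) (.eq ?_ ?_)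
      · refine .prodMk ?_ (by fun_prop)
        intro j
        simp only [Equiv.apply_symm_apply]
        exact DefinableFun.proj (α := Option (idx R T) ⊕ idx R T') L (A := univ)
          (i := Sum.inl (some j))
      · intro _
        exact DefMap.snd (L := L) (f := fun p : (Option (idx R T) → R) × T' => p) .id i
      · fun_prop)
  have h' : (univ : Set R).Definable L {v : Option (idx R T) → R |
    ∃ y, f (coord.symm (v ∘ some)) = y ∧ coord (R := R) y i = v none} := h
  unfold DefinableFun
  convert h' using 1
  ext v
  simp [Function.tupleGraph]

/-- Definable unique choice. -/
theorem exists_defMap_of_unique [Nonempty R] {H : T → T' → Prop} (hH : DefPred L R fun p : T × T' => H p.1 p.2)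
    (hu : ∀ x y y', H x y → H x y' → y = y') :
    ∃ h : T → T', DefMap L R h ∧ ∀ x, (∃ y, H x y) → H x (h x) := by
  classical
  -- A fixed default value where no witness exists, which keeps the graph definable.
  let z : T' := (coord (R := R)).symm fun _ => Classical.arbitrary R
  refine ⟨fun x => if hx : ∃ y, H x y then hx.choose else z, .of_graph ?_, fun x hx => ?_⟩
  · have : DefPred L R fun p : T × T' => H p.1 p.2 ∨ ((¬ ∃ y, H p.1 y) ∧ p.2 = z) :=
      hH.or (.and (.not (.ex (hH.comp (f := fun q : (T × T') × T' => (q.1.1, q.2))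
        (by fun_prop)))) (.eq (by fun_prop) (by fun_prop)))
    refine this.of_iff fun p => ?_
    by_cases hx : ∃ y, H p.1 y
    · simp only [hx, dite_true, not_true, false_and, or_false]
      exact ⟨fun h => h ▸ hx.choose_spec, fun h => hu _ _ _ hx.choose_spec h⟩
    · simp only [hx, dite_false, not_false_iff, true_and]
      exact ⟨fun h => Or.inr h.symm, fun h => (h.resolve_left fun h => hx ⟨_, h⟩).symm⟩
  · simp only [hx, dite_true]
    exact hx.choose_spec

section Field

variable [Field R] [LinearOrder R] [ExpandsOrderedField L R]

theorem DefPred.lt {f g : T → R} (hf : DefMap L R f) (hg : DefMap L R g) :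
    DefPred L R fun x => f x < g x := by
  have h : DefPred L R fun x : Fin 2 → R => x 0 < x 1 := ExpandsOrderedField.definable_lt
  refine h.comp (f := fun x => ![f x, g x]) (.pi fun i => ?_)
  fin_cases i <;> assumption

theorem DefPred.le {f g : T → R} (hf : DefMap L R f) (hg : DefMap L R g) :
    DefPred L R fun x => f x ≤ g x :=
  (DefPred.lt hg hf).not.of_iff fun _ => not_lt.symm

@[fun_prop]
theorem DefMap.add {f g : T → R} (hf : DefMap L R f) (hg : DefMap L R g) :
    DefMap L R fun x => f x + g x := by
  have h : DefPred L R fun x : Fin 3 → R => x 0 + x 1 = x 2 := ExpandsOrderedField.definable_add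
  refine .of_graph (h.comp (f := fun p : T × R => ![f p.1, g p.1, p.2]) (.pi fun i => ?_))
  fin_cases i <;> simp <;> fun_prop

@[fun_prop]
theorem DefMap.mul {f g : T → R} (hf : DefMap L R f) (hg : DefMap L R g) :
    DefMap L R fun x => f x * g x := by
  have h : DefPred L R fun x : Fin 3 → R => x 0 * x 1 = x 2 := ExpandsOrderedField.definable_mul
  refine .of_graph (h.comp (f := fun p : T × R => ![f p.1, g p.1, p.2]) (.pi fun i => ?_))
  fin_cases i <;> simp <;> fun_prop

@[fun_prop]
theorem DefMap.neg {f : T → R} (hf : DefMap L R f) : DefMap L R fun x => - f x := by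
  simpa using DefMap.mul (L := L) (DefMap.const (T := T) (-1 : R)) hf

@[fun_prop]
theorem DefMap.sub {f g : T → R} (hf : DefMap L R f) (hg : DefMap L R g) :
    DefMap L R fun x => f x - g x := by
  simp only [sub_eq_add_neg]
  fun_prop

@[fun_prop]
theorem DefMap.max {f g : T → R} (hf : DefMap L R f) (hg : DefMap L R g) :
    DefMap L R fun x => max (f x) (g x) := by
  refine .of_graph ?_
  have : DefPred L R fun p : T × R => (f p.1 ≤ g p.1 ∧ g p.1 = p.2) ∨ (g p.1 < f p.1 ∧ f p.1 = p.2) :=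
    .or (.and (.le (by fun_prop) (by fun_prop)) (.eq (by fun_prop) (by fun_prop)))
      (.and (.lt (by fun_prop) (by fun_prop)) (.eq (by fun_prop) (by fun_prop)))
  refine this.of_iff fun p => ?_
  rcases le_or_gt (f p.1) (g p.1) with h | h
  · simp [h, h.not_gt]
  · simp [h, h.le, h.not_ge]

@[fun_prop]
theorem DefMap.abs {f : T → R} (hf : DefMap L R f) : DefMap L R fun x => |f x| :=
  DefMap.max (L := L) hf hf.neg

end Field

end Definability

/-! ### Points and intervals of the line. -/

section UnaryOMinimality

variable {R : Type w} [LinearOrder R]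

theorem IsPointOrInterval.finite_or_exists_Ioo [DenselyOrdered R] [NoMinOrder R] [NoMaxOrder R]
    [Nonempty R] {I : Set R} (hI : IsPointOrInterval I) : I.Finite ∨ ∃ a b, a < b ∧ Ioo a b ⊆ I := by
  rcases hI with ⟨a, rfl⟩ | ⟨a, b, rfl⟩ | ⟨a, rfl⟩ | ⟨a, rfl⟩ | rfl
  · exact Or.inl (finite_singleton a)
  · rcases lt_or_ge a b with h | h
    · exact Or.inr ⟨a, b, h, Subset.rfl⟩
    · exact Or.inl (by simp [Ioo_eq_empty h.not_gt])
  · obtain ⟨b, hb⟩ := exists_lt a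
    exact Or.inr ⟨b, a, hb, fun x hx => hx.2⟩
  · obtain ⟨b, hb⟩ := exists_gt a
    exact Or.inr ⟨a, b, hb, fun x hx => hx.1⟩
  · obtain ⟨a⟩ := ‹Nonempty R›
    obtain ⟨b, hb⟩ := exists_gt a
    exact Or.inr ⟨a, b, hb, subset_univ _⟩

theorem IsPointOrInterval.exists_isGLB [DenselyOrdered R] [NoMinOrder R] [NoMaxOrder R]
    {I : Set R} (hI : IsPointOrInterval I) (hne : I.Nonempty) (hb : BddBelow I) :
    ∃ g, IsGLB I g := by
  rcases hI with ⟨a, rfl⟩ | ⟨a, b, rfl⟩ | ⟨a, rfl⟩ | ⟨a, rfl⟩ | rfl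
  · exact ⟨a, isGLB_singleton⟩
  · exact ⟨a, isGLB_Ioo (by simpa using hne)⟩
  · exact absurd hb (not_bddBelow_Iio a)
  · exact ⟨a, isGLB_Ioi⟩
  · exact absurd hb (by have := hne.to_type; exact not_bddBelow_univ)

end UnaryOMinimality

/-! ### One-variable consequences of o-minimality. -/

section OMinimal

variable {L : FirstOrder.Language.{u, v}} {R : Type w} [L.Structure R]
  [Field R] [LinearOrder R] [IsStrictOrderedRing R] [IsOMinimal L R]

theorem DefPred.exists_finite_union {P : R → Prop} (hP : DefPred L R P) :
    ∃ F : Set (Set R), F.Finite ∧ (∀ I ∈ F, IsPointOrInterval I) ∧ {y | P y} = ⋃₀ F := by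
  refine IsOMinimal.finite_union (L := L) _ ?_
  have := Definable.preimage_comp (fun _ : Unit => (0 : Fin 1)) hP
  exact this

theorem DefPred.exists_interval {P : R → Prop} (hP : DefPred L R P) (h : {y | P y}.Infinite) :
    ∃ a b, a < b ∧ ∀ y, a < y → y < b → P y := by
  obtain ⟨F, hF, hI, hPF⟩ := hP.exists_finite_union
  by_contra hc
  refine h (hPF ▸ hF.sUnion fun I hIF => ?_)
  refine (hI I hIF).finite_or_exists_Ioo.resolve_right ?_
  rintro ⟨a, b, hab, hs⟩
  refine hc ⟨a, b, hab, fun y hy hy' => ?_⟩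
  have : y ∈ {y | P y} := hPF ▸ ⟨I, hIF, hs ⟨hy, hy'⟩⟩
  exact this

/-- Definable completeness, which stands in for Dedekind completeness throughout. Each nonempty
piece that is bounded below has an infimum, and the pieces are finite in number. -/
theorem DefPred.exists_isGLB {P : R → Prop} (hP : DefPred L R P) (hne : ∃ y, P y)
    (hb : ∃ b, ∀ y, P y → b ≤ y) : ∃ g, IsGLB {y | P y} g := by
  obtain ⟨F, hF, hI, hPF⟩ := hP.exists_finite_union
  have hne' : {y | P y}.Nonempty := hne
  have hb' : BddBelow {y | P y} := hb.imp fun b hb y hy => hb y hy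
  rw [hPF] at hne' hb' ⊢
  clear hPF hne hb
  induction F, hF using Set.Finite.induction_on with
  | empty => simp at hne'
  | @insert I F _ _ ih =>
    rw [sUnion_insert] at hne' hb' ⊢
    have h1 := hI I (mem_insert I F)
    rcases I.eq_empty_or_nonempty with rfl | hIne
    · rw [empty_union] at hne' hb' ⊢
      exact ih (fun J hJ => hI J (mem_insert_of_mem _ hJ)) hne' hb'
    obtain ⟨g, hg⟩ := h1.exists_isGLB hIne (hb'.mono subset_union_left)
    rcases (⋃₀ F).eq_empty_or_nonempty with he | hFne
    · exact ⟨g, by simpa [he] using hg⟩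
    obtain ⟨g', hg'⟩ := ih (fun J hJ => hI J (mem_insert_of_mem _ hJ)) hFne
      (hb'.mono subset_union_right)
    exact ⟨_, hg.union hg'⟩

variable [ExpandsOrderedField L R]

theorem DefPred.isGLB {T : Type*} [Coordinatized R T] {A : T → R → Prop}
    (hA : DefPred L R fun p : T × R => A p.1 p.2) :
    DefPred L R fun p : T × R => IsGLB {y | A p.1 y} p.2 := by
  have : DefPred L R fun p : T × R => ∀ b, (b ≤ p.2 ↔ ∀ y, A p.1 y → b ≤ y) :=
    .all (.iff (.le (by fun_prop) (by fun_prop)) (.all (.imp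
      (hA.comp (f := fun q : ((T × R) × R) × R => (q.1.1.1, q.2)) (by fun_prop))
      (.le (by fun_prop) (by fun_prop)))))
  exact this.of_iff fun p => isGLB_iff_le_iff

theorem DefPred.exists_isLUB {P : R → Prop} (hP : DefPred L R P) (hne : ∃ y, P y)
    (hb : ∃ b, ∀ y, P y → y ≤ b) : ∃ g, IsLUB {y | P y} g := by
  obtain ⟨g, hg⟩ := DefPred.exists_isGLB (L := L) (P := fun y => P (-y))
    (hP.comp (f := fun y => -y) (by fun_prop)) (by
      obtain ⟨y, hy⟩ := hne; exact ⟨-y, by simpa⟩)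
    (by obtain ⟨b, hb⟩ := hb; exact ⟨-b, fun y hy => by linarith [hb _ hy]⟩)
  refine ⟨-g, ?_⟩
  have : {y | P y} = -{y | P (-y)} := by ext; simp
  rw [this]
  exact hg.neg

theorem DefPred.isLUB {T : Type*} [Coordinatized R T] {A : T → R → Prop}
    (hA : DefPred L R fun p : T × R => A p.1 p.2) :
    DefPred L R fun p : T × R => IsLUB {y | A p.1 y} p.2 := by
  have : DefPred L R fun p : T × R => ∀ b, (p.2 ≤ b ↔ ∀ y, A p.1 y → y ≤ b) :=
    .all (.iff (.le (by fun_prop) (by fun_prop)) (.all (.imp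
      (hA.comp (f := fun q : ((T × R) × R) × R => (q.1.1.1, q.2)) (by fun_prop))
      (.le (by fun_prop) (by fun_prop)))))
  exact this.of_iff fun p => isLUB_iff_le_iff

/-- On an interval, a positive definable function is bounded away from zero on some subinterval. -/
theorem exists_interval_of_forall_pos {P : R → R → Prop}
    (hP : DefPred L R fun p : R × R => P p.1 p.2)
    (hmono : ∀ y s t, 0 < s → s ≤ t → P y t → P y s) {a b : R} (hab : a < b)
    (h : ∀ y, a < y → y < b → ∃ t, 0 < t ∧ P y t) :
    ∃ t, 0 < t ∧ ∃ a' b', a' < b' ∧ ∀ y, a' < y → y < b' → P y t := by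
  by_contra! hc
  have hfin : ∀ t, 0 < t → {y | P y t}.Finite := by
    intro t ht
    by_contra hinf
    obtain ⟨a', b', hab', h'⟩ := DefPred.exists_interval (L := L) (P := fun y => P y t)
      (hP.comp (f := fun y => (y, t)) (by fun_prop)) hinf
    obtain ⟨y, h1, h2, h3⟩ := hc t ht a' b' hab'
    exact h3 (h' y h1 h2)
  -- Truncating at `1` guarantees a supremum at each point; the values of these suprema decide the
  -- argument.
  let A : R → R → Prop := fun y t => 0 < t ∧ t ≤ 1 ∧ P y t
  have hA : DefPred L R fun p : R × R => A p.1 p.2 :=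
    .and (.lt (by fun_prop) (by fun_prop)) (.and (.le (by fun_prop) (by fun_prop)) hP)
  have hlub : ∀ y, a < y → y < b → ∃ c, 0 < c ∧ IsLUB {t | A y t} c := by
    intro y h1 h2
    obtain ⟨t, ht, hPt⟩ := h y h1 h2
    have hAt : A y (min t 1) := ⟨lt_min ht one_pos, min_le_right _ _,
      hmono _ _ _ (lt_min ht one_pos) (min_le_left _ _) hPt⟩
    obtain ⟨c, hc⟩ := DefPred.exists_isLUB (L := L) (P := A y)
      (hA.comp (f := fun t => (y, t)) (by fun_prop)) ⟨_, hAt⟩ ⟨1, fun t ht => ht.2.1⟩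
    exact ⟨c, hAt.1.trans_le (hc.1 hAt), hc⟩
  have happ : ∀ y c m, IsLUB {t | A y t} c → 0 < m → m < c → P y m := by
    intro y c m hc hm hmc
    obtain ⟨t, ht, hmt, _⟩ := hc.exists_between hmc
    exact hmono _ _ _ hm hmt.le ht.2.2
  let C : R → Prop := fun c => ∃ y, (a < y ∧ y < b) ∧ IsLUB {t | A y t} c
  have hC : DefPred L R C := .ex (.and (.and (.lt (by fun_prop) (by fun_prop))
    (.lt (by fun_prop) (by fun_prop))) ((DefPred.isLUB hA).comp
      (f := fun p : R × R => (p.2, p.1)) (by fun_prop)))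
  have hCpos : ∀ c, C c → 0 < c := by
    rintro c ⟨y, ⟨h1, h2⟩, hc⟩
    obtain ⟨c', hc', h'⟩ := hlub y h1 h2
    rwa [hc.unique h']
  -- With only finitely many suprema `c`, the interval would be covered by the finite sets where `P
  -- y (c / 2)` holds.
  have hCinf : {c | C c}.Infinite := by
    intro hCfin
    refine Ioo_infinite hab ((hCfin.biUnion (t := fun c => {y | P y (c / 2)}) fun c hc =>
      hfin _ (half_pos (hCpos c hc))).subset ?_)
    rintro y ⟨h1, h2⟩
    obtain ⟨c, hc, h'⟩ := hlub y h1 h2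
    simp only [mem_iUnion]
    exact ⟨c, ⟨y, ⟨h1, h2⟩, h'⟩, happ _ _ _ h' (half_pos hc) (half_lt_self hc)⟩
  obtain ⟨a', b', hab', hC'⟩ := hC.exists_interval hCinf
  obtain ⟨m, hm1, hm2⟩ := exists_between hab'
  have hm := hCpos m (hC' m hm1 hm2)
  have hex : ∀ c : Ioo m b', ∃ y, IsLUB {t | A y t} c.1 := fun c =>
    (hC' c (hm1.trans c.2.1) c.2.2).imp fun y hy => hy.2
  choose g hg using hex
  -- A whole interval of suprema above `m` comes from pairwise distinct points, and at all of them
  -- `P y m` holds, contradicting finiteness.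
  have hginj : Function.Injective g := fun c c' hcc => by
    have h1 := hg c
    rw [hcc] at h1
    exact Subtype.ext (h1.unique (hg c'))
  have := (Ioo_infinite hm2).to_subtype
  exact infinite_range_of_injective hginj ((hfin m hm).subset (by
    rintro _ ⟨c, rfl⟩
    exact happ _ _ _ (hg c) hm c.2.1))

end OMinimal

/-! ### Definable sets with interior: the Baire property by induction on dimension. -/

section Interior

variable {L : FirstOrder.Language.{u, v}} {R : Type w} [L.Structure R]
  [Field R] [LinearOrder R] [IsStrictOrderedRing R] [IsOMinimal L R] [ExpandsOrderedField L R]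
  {d k : ℕ}

/-- The open cube with centre `c` and half side `r`. -/
def Cube {d : ℕ} (c : Fin d → R) (r : R) (z : Fin d → R) : Prop := ∀ i, |z i - c i| < r

/-- The predicate `P` holds on some open cube. -/
def HasInt {d : ℕ} (P : (Fin d → R) → Prop) : Prop := ∃ c r, 0 < r ∧ ∀ z, Cube c r z → P z

theorem HasInt.mono {P Q : (Fin d → R) → Prop} (hP : HasInt P) (h : ∀ z, P z → Q z) : HasInt Q := by
  obtain ⟨c, r, hr, hP⟩ := hP
  exact ⟨c, r, hr, fun z hz => h z (hP z hz)⟩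

theorem Cube.self (c : Fin d → R) {r : R} (hr : 0 < r) : Cube c r c := fun i => by simpa

theorem HasInt.exists {P : (Fin d → R) → Prop} (hP : HasInt P) : ∃ z, P z := by
  obtain ⟨c, r, hr, hP⟩ := hP
  exact ⟨c, hP c (.self c hr)⟩

variable {T : Type*} [Coordinatized R T]

theorem DefPred.cube {c z : T → Fin d → R} {r : T → R} (hc : DefMap L R c) (hr : DefMap L R r)
    (hz : DefMap L R z) : DefPred L R fun x => Cube (c x) (r x) (z x) :=
  .finite_all fun i => .lt (by fun_prop) (by fun_prop)

theorem DefPred.hasInt {P : T → (Fin d → R) → Prop}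
    (hP : DefPred L R fun p : T × (Fin d → R) => P p.1 p.2) :
    DefPred L R fun x => HasInt (P x) :=
  .ex (.ex (.and (.lt (by fun_prop) (by fun_prop)) (.all (.imp
    (.cube (by fun_prop) (by fun_prop) (by fun_prop))
    (hP.comp (f := fun q : ((T × (Fin d → R)) × R) × (Fin d → R) => (q.1.1.1, q.2))
      (by fun_prop))))))

variable (L R) in
/-- In dimension `d`, a finite union of definable sets without interior has no interior, and an
increasing definable union of sets without interior has no interior. -/
structure BaireProperty (d : ℕ) : Prop where
  union : ∀ P Q : (Fin d → R) → Prop, DefPred L R P → DefPred L R Q →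
    HasInt (fun x => P x ∨ Q x) → HasInt P ∨ HasInt Q
  directed : ∀ P : (Fin d → R) → R → Prop,
    DefPred L R (fun p : (Fin d → R) × R => P p.1 p.2) →
    (∀ x s t, 0 < s → s ≤ t → P x t → P x s) →
    HasInt (fun x => ∃ t, 0 < t ∧ P x t) → ∃ t, 0 < t ∧ HasInt fun x => P x t

/-- A definable function is nearly constant on some cube. -/
theorem BaireProperty.exists_nearly_const (hB : BaireProperty L R d) {Q : (Fin d → R) → Prop}
    (hQ : DefPred L R Q) (hQi : HasInt Q) {h : (Fin d → R) → R} (hh : DefMap L R h) {ε : R}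
    (hε : 0 < ε) : ∃ v, HasInt fun z => Q z ∧ |h z - v| ≤ ε := by
  -- The bound `|h x| ≤ 1 / t` exhausts everything as `t` decreases to `0`, so `h` may be assumed
  -- bounded.
  obtain ⟨t, ht, hQt⟩ := hB.directed (fun x t => Q x ∧ |h x| * t ≤ 1)
    (.and (hQ.comp (by fun_prop)) (.le (by fun_prop) (by fun_prop)))
    (fun x s t hs hst hx => ⟨hx.1, le_trans (mul_le_mul_of_nonneg_left hst (abs_nonneg _)) hx.2⟩)
    (hQi.mono fun z hz => ⟨(|h z| + 1)⁻¹, by positivity, hz, by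
      rw [mul_inv_le_iff₀ (by positivity)]; linarith⟩)
  have habs : ∀ x, |h x| * t ≤ 1 → |h x| ≤ t⁻¹ := fun x hx => by
    rwa [← one_div, le_div_iff₀ ht]
  let Q' : (Fin d → R) → Prop := fun x => Q x ∧ |h x| * t ≤ 1
  have hQ' : DefPred L R Q' := .and hQ (.le (by fun_prop) (by fun_prop))
  let C : R → Prop := fun c => HasInt fun x => Q' x ∧ h x ≤ c
  have hC : DefPred L R C := .hasInt (.and (hQ'.comp (f := fun p : R × (Fin d → R) => p.2)
    (by fun_prop)) (.le (by fun_prop) (by fun_prop)))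
  obtain ⟨g, hg⟩ := hC.exists_isGLB
    ⟨t⁻¹, hQt.mono fun z hz => ⟨hz, (le_abs_self _).trans (habs z hz.2)⟩⟩
    ⟨-t⁻¹, fun c hc => by
      obtain ⟨z, hz, hzc⟩ := hc.exists
      exact le_trans (neg_le_of_abs_le (habs z hz.2)) hzc⟩
  obtain ⟨c, hc, hgc, hcg⟩ := hg.exists_between (show g < g + ε by linarith)
  refine ⟨g, ?_⟩
  -- As `g` is the least level whose sublevel sets acquire interior, removing the part below `g - ε`
  -- must leave interior.
  rcases hB.union (fun x => Q' x ∧ h x ≤ g - ε) (fun x => Q' x ∧ g - ε < h x ∧ h x ≤ c)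
    (.and hQ' (.le (by fun_prop) (by fun_prop)))
    (.and hQ' (.and (.lt (by fun_prop) (by fun_prop)) (.le (by fun_prop) (by fun_prop))))
    (HasInt.mono hc fun z hz => (le_or_gt (h z) (g - ε)).imp (fun h => ⟨hz.1, h⟩)
      fun h => ⟨hz.1, h, hz.2⟩) with hi | hi
  · have := hg.1 (show C (g - ε) from hi)
    linarith
  · exact hi.mono fun z hz => ⟨hz.1.1, abs_le.2 ⟨by linarith [hz.2.1], by linarith [hz.2.2]⟩⟩

/-- One coordinate is treated at a time; the set obtained so far becomes the new `Q`, so earlier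
estimates survive. -/
theorem BaireProperty.exists_nearly_const_pi (hB : BaireProperty L R d) {Q : (Fin d → R) → Prop}
    (hQ : DefPred L R Q) (hQi : HasInt Q) {h : (Fin d → R) → Fin k → R} (hh : DefMap L R h) {ε : R}
    (hε : 0 < ε) : ∃ v : Fin k → R, HasInt fun z => Q z ∧ ∀ i, |h z i - v i| ≤ ε := by
  classical
  suffices H : ∀ s : Finset (Fin k), ∃ v : Fin k → R,
      HasInt fun z => Q z ∧ ∀ i ∈ s, |h z i - v i| ≤ ε by
    simpa using H Finset.univ
  intro s
  induction s using Finset.induction_on with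
  | empty => exact ⟨0, by simpa using hQi⟩
  | insert j s hj ih =>
    obtain ⟨v, hv⟩ := ih
    obtain ⟨a, ha⟩ := hB.exists_nearly_const (Q := fun z => Q z ∧ ∀ i ∈ s, |h z i - v i| ≤ ε)
      (h := fun z => h z j) (.and hQ (.of_iff (.finite_all fun i : s =>
        (.le (by fun_prop) (by fun_prop) : DefPred L R fun z => |h z i - v i| ≤ ε)) (by simp)))
      hv (by fun_prop) hε
    refine ⟨Function.update v j a, ha.mono fun z hz => ⟨hz.1.1, fun i hi => ?_⟩⟩
    by_cases hij : i = j
    · subst hij; simpa using hz.2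
    · rw [Function.update_of_ne hij]
      exact hz.1.2 i (Finset.mem_of_mem_insert_of_ne hi hij)

theorem DefMap.finCons {y : T → R} {x : T → Fin d → R} (hy : DefMap L R y) (hx : DefMap L R x) :
    DefMap L R fun t => (Fin.cons (y t) (x t) : Fin (d + 1) → R) :=
  .pi fun i => by
    cases i using Fin.cases
    · simpa using hy
    · simp only [Fin.cons_succ]; fun_prop

/-- A definable set in `R ^ (d + 1)` whose fibres over some cube of `R ^ d` contain intervals
contains a cube. -/
theorem BaireProperty.hasInt_of_fibres (hB : BaireProperty L R d) {P : (Fin (d + 1) → R) → Prop}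
    (hP : DefPred L R P)
    (h : HasInt fun x : Fin d → R => ∃ a b, a < b ∧ ∀ y, a < y → y < b → P (Fin.cons y x)) :
    HasInt P := by
  -- One parameter `t` bounds from below the length of an interval in the fibre and, through `|a| ≤
  -- 1 / t`, keeps its left endpoint bounded, so that the least left endpoint exists.
  let A : R → (Fin d → R) → R → Prop := fun t x a =>
    |a| * t ≤ 1 ∧ ∀ y, a < y → y < a + t → P (Fin.cons y x)
  have hA : DefPred L R fun p : (R × (Fin d → R)) × R => A p.1.1 p.1.2 p.2 :=
    .and (.le (by fun_prop) (by fun_prop)) (.all (.imp (.lt (by fun_prop) (by fun_prop))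
      (.imp (.lt (by fun_prop) (by fun_prop)) (hP.comp (.finCons (by fun_prop) (by fun_prop))))))
  obtain ⟨t, ht, hi⟩ := hB.directed (fun x t => ∃ a, A t x a)
    (.ex (hA.comp (f := fun q : ((Fin d → R) × R) × R => ((q.1.2, q.1.1), q.2)) (by fun_prop)))
    (fun x s t hs hst => by
      rintro ⟨a, ha, hat⟩
      exact ⟨a, le_trans (mul_le_mul_of_nonneg_left hst (abs_nonneg _)) ha,
        fun y h1 h2 => hat y h1 (by linarith)⟩)
    (h.mono fun x hx => by
      obtain ⟨a, b, hab, hP⟩ := hx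
      refine ⟨min (b - a) (|a| + 1)⁻¹, lt_min (by linarith) (by positivity), a, ?_, ?_⟩
      · refine le_trans (mul_le_mul_of_nonneg_left (min_le_right _ _) (abs_nonneg _)) ?_
        rw [mul_inv_le_iff₀ (by positivity)]; linarith
      · intro y h1 h2
        exact hP y h1 (by linarith [min_le_left (b - a) (|a| + 1)⁻¹]))
  have hAt : DefPred L R fun p : (Fin d → R) × R => A t p.1 p.2 :=
    hA.comp (f := fun p : (Fin d → R) × R => ((t, p.1), p.2)) (by fun_prop)
  obtain ⟨α, hα, hαg⟩ := exists_defMap_of_unique (L := L)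
    (H := fun (x : Fin d → R) (g : R) => IsGLB {a | A t x a} g) (.isGLB hAt)
    fun x g g' h1 h2 => h1.unique h2
  have hglb : ∀ x, (∃ a, A t x a) → IsGLB {a | A t x a} (α x) := fun x hx =>
    hαg x (DefPred.exists_isGLB (L := L)
      (hAt.comp (f := fun a => (x, a)) (by fun_prop)) hx ⟨-t⁻¹, fun a ha => by
        refine neg_le_of_abs_le ?_
        rw [← one_div, le_div_iff₀ ht]
        exact ha.1⟩)
  obtain ⟨v, c, r, hr, hv⟩ := hB.exists_nearly_const (.ex hAt) hi hα (show 0 < t / 4 by positivity)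
  -- Here `α` lies within `t / 4` of `v`, while the first coordinate of a point of this cube is
  -- strictly between `v + t / 4` and `v + 3t / 4`, hence between `α` and `α + t`. The infimum
  -- itself need not be admissible, so an admissible `a` just above it is used.
  refine ⟨Fin.cons (v + t / 2) c, min r (t / 4), lt_min hr (by positivity), fun z hz => ?_⟩
  have hz0 := hz 0
  obtain ⟨hA1, hα1⟩ := hv (Fin.tail z) fun i =>
    (hz i.succ).trans_le (min_le_left _ _)
  have hg := hglb _ hA1
  rw [Fin.cons_zero, lt_min_iff, abs_lt, abs_lt] at hz0
  rw [abs_le] at hα1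
  obtain ⟨a, ha, hga, haz⟩ := hg.exists_between (show α (Fin.tail z) < z 0 by linarith)
  have := ha.2 (z 0) haz (by linarith)
  rwa [Fin.cons_self_tail] at this

theorem BaireProperty.zero : BaireProperty L R 0 where
  union P Q _ _ h := by
    obtain ⟨z, hz⟩ := h.exists
    exact hz.imp (fun h => ⟨z, 1, one_pos, fun w _ => Subsingleton.elim z w ▸ h⟩)
      (fun h => ⟨z, 1, one_pos, fun w _ => Subsingleton.elim z w ▸ h⟩)
  directed P _ _ h := by
    obtain ⟨z, t, ht, hz⟩ := h.exists
    exact ⟨t, ht, z, 1, one_pos, fun w _ => Subsingleton.elim z w ▸ hz⟩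

theorem Cube.cons {c : Fin (d + 1) → R} {r y : R} {x : Fin d → R} (hx : Cube (Fin.tail c) r x)
    (h1 : c 0 - r < y) (h2 : y < c 0 + r) : Cube c r (Fin.cons y x) := by
  intro i
  cases i using Fin.cases
  · simp only [Fin.cons_zero, abs_lt]
    constructor <;> linarith
  · simpa [Fin.tail] using hx _

/-- Both parts are reduced to the base by replacing a set with the set of base points whose fibre
contains an interval. The one-variable facts handle the fibres, the induction hypothesis the base,
and `hasInt_of_fibres` reassembles a cube. -/
theorem BaireProperty.succ (hB : BaireProperty L R d) : BaireProperty L R (d + 1) where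
  union P Q hP hQ := by
    rintro ⟨c, r, hr, h⟩
    have hI : ∀ {P : (Fin (d + 1) → R) → Prop}, DefPred L R P →
        DefPred L R fun x : Fin d → R => ∃ a b, a < b ∧ ∀ y, a < y → y < b → P (Fin.cons y x) :=
      fun hP => .ex (.ex (.and (.lt (by fun_prop) (by fun_prop)) (.all (.imp
        (.lt (by fun_prop) (by fun_prop)) (.imp (.lt (by fun_prop) (by fun_prop))
          (hP.comp (.finCons (by fun_prop) (by fun_prop))))))))
    refine (hB.union _ _ (hI hP) (hI hQ) ⟨Fin.tail c, r, hr, fun x hx => ?_⟩).imp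
      (hB.hasInt_of_fibres hP) (hB.hasInt_of_fibres hQ)
    have hs : ∀ {P : (Fin (d + 1) → R) → Prop}, DefPred L R P →
        DefPred L R fun y => P (Fin.cons y x) :=
      fun hP => hP.comp (.finCons (by fun_prop) (by fun_prop))
    have hinf : ({y | P (Fin.cons y x)} ∪ {y | Q (Fin.cons y x)}).Infinite :=
      (Ioo_infinite (show c 0 - r < c 0 + r by linarith)).mono fun y hy => h _ (hx.cons hy.1 hy.2)
    exact (infinite_union.1 hinf).imp (hs hP).exists_interval (hs hQ).exists_interval
  directed P hP hmono := by
    rintro ⟨c, r, hr, h⟩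
    obtain ⟨t, ht, hi⟩ := hB.directed
      (fun x t => ∃ a b, a < b ∧ ∀ y, a < y → y < b → P (Fin.cons y x) t)
      (.ex (.ex (.and (.lt (by fun_prop) (by fun_prop)) (.all (.imp
        (.lt (by fun_prop) (by fun_prop)) (.imp (.lt (by fun_prop) (by fun_prop))
          (hP.comp (.prodMk (.finCons (by fun_prop) (by fun_prop)) (by fun_prop)))))))))
      (fun x s t hs hst => by
        rintro ⟨a, b, hab, hab'⟩
        exact ⟨a, b, hab, fun y h1 h2 => hmono _ _ _ hs hst (hab' y h1 h2)⟩)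
      ⟨Fin.tail c, r, hr, fun x hx => exists_interval_of_forall_pos (L := L)
        (P := fun y t => P (Fin.cons y x) t)
        (hP.comp (.prodMk (.finCons (by fun_prop) (by fun_prop)) (by fun_prop)))
        (fun y s t => hmono _ s t) (show c 0 - r < c 0 + r by linarith)
        fun y h1 h2 => h _ (hx.cons h1 h2)⟩
    refine ⟨t, ht, hB.hasInt_of_fibres (P := fun z => P z t) ?_ hi⟩
    exact hP.comp (f := fun z => (z, t)) (by fun_prop)

variable (L R) in
theorem baireProperty : ∀ d, BaireProperty L R d
  | 0 => .zero
  | d + 1 => (baireProperty d).succ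

end Interior

/-! ### Closures and frontiers of definable sets. -/

section Closure

variable {L : FirstOrder.Language.{u, v}} {R : Type w} [L.Structure R]
  [Field R] [LinearOrder R] [IsStrictOrderedRing R] [IsOMinimal L R] [ExpandsOrderedField L R]
  {d k : ℕ}

/-- The topological closure of a predicate, expressed by cubes. -/
def Cl {k : ℕ} (P : (Fin k → R) → Prop) (z : Fin k → R) : Prop :=
  ∀ r, 0 < r → ∃ w, P w ∧ Cube z r w

theorem Cl.of_mem {P : (Fin k → R) → Prop} {z : Fin k → R} (h : P z) : Cl P z :=
  fun _ hr => ⟨z, h, .self z hr⟩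

theorem Cl.mono {P Q : (Fin k → R) → Prop} (h : ∀ z, P z → Q z) {z : Fin k → R} (hz : Cl P z) :
    Cl Q z := fun r hr => (hz r hr).imp fun w hw => ⟨h w hw.1, hw.2⟩

theorem Cube.shrink {c z : Fin k → R} {r : R} (hz : Cube c r z) :
    ∃ s, 0 < s ∧ ∀ w, Cube z s w → Cube c r w := by
  suffices H : ∀ t : Finset (Fin k), ∃ s, 0 < s ∧ ∀ w : Fin k → R, Cube z s w →
      ∀ i ∈ t, |w i - c i| < r by
    obtain ⟨s, hs, h⟩ := H Finset.univ
    exact ⟨s, hs, fun w hw i => h w hw i (Finset.mem_univ i)⟩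
  classical
  intro t
  induction t using Finset.induction_on with
  | empty => exact ⟨1, one_pos, by simp⟩
  | insert j t _ ih =>
    obtain ⟨s, hs, h⟩ := ih
    refine ⟨min s (r - |z j - c j|), lt_min hs (sub_pos.2 (hz j)), fun w hw i hi => ?_⟩
    rcases Finset.mem_insert.1 hi with rfl | hi
    · have h1 := (hw i).trans_le (min_le_right _ _)
      have h2 := abs_add_le (w i - z i) (z i - c i)
      rw [sub_add_sub_cancel] at h2
      linarith
    · exact h w (fun i => (hw i).trans_le (min_le_left _ _)) i hi

theorem Cl.idem {P : (Fin k → R) → Prop} {z : Fin k → R} (hz : Cl (Cl P) z) : Cl P z := by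
  intro r hr
  obtain ⟨w, hw, hzw⟩ := hz r hr
  obtain ⟨s, hs, h⟩ := hzw.shrink
  obtain ⟨y, hy, hwy⟩ := hw s hs
  exact ⟨y, hy, h y hwy⟩

theorem DefPred.cl {P : (Fin k → R) → Prop} (hP : DefPred L R P) : DefPred L R (Cl P) :=
  .all (.imp (.lt (by fun_prop) (by fun_prop)) (.ex (.and (hP.comp (by fun_prop))
    (.cube (by fun_prop) (by fun_prop) (by fun_prop)))))

/-- On a cube inside the closure, the complement of `P` cannot contain a smaller cube, so by the
union property `P` must. -/
theorem HasInt.of_cl {P : (Fin d → R) → Prop} (hP : DefPred L R P) (h : HasInt (Cl P)) :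
    HasInt P := by
  obtain ⟨c, r, hr, h⟩ := h
  refine ((baireProperty L R d).union P (fun z => Cube c r z ∧ ¬ P z) hP
    (.and (.cube (by fun_prop) (by fun_prop) (by fun_prop)) hP.not)
    ⟨c, r, hr, fun z hz => (em (P z)).imp_right fun h => ⟨hz, h⟩⟩).resolve_right ?_
  rintro ⟨c', r', hr', h'⟩
  obtain ⟨w, hw, hw'⟩ := h c' (h' c' (.self c' hr')).1 r' hr'
  exact (h' w hw').2 hw

theorem exists_cube_disjoint {S : Set (Fin k → R)} (hS : S.Finite) {z : Fin k → R} (hz : z ∉ S) :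
    ∃ t, 0 < t ∧ ∀ w ∈ S, ¬ Cube z t w := by
  induction S, hS using Set.Finite.induction_on with
  | empty => exact ⟨1, one_pos, by simp⟩
  | @insert a S _ _ ih =>
    rw [mem_insert_iff, not_or] at hz
    obtain ⟨t, ht, h⟩ := ih hz.2
    obtain ⟨i, hi⟩ := Function.ne_iff.1 hz.1
    refine ⟨min t |a i - z i|, lt_min ht (abs_pos.2 (sub_ne_zero.2 hi.symm)), fun w hw hc => ?_⟩
    rcases hw with rfl | hw
    · exact ((hc i).trans_le (min_le_right _ _)).false
    · exact h w hw fun i => (hc i).trans_le (min_le_left _ _)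

theorem DefPred.lexLE : DefPred L R fun p : (Fin k → R) × (Fin k → R) => toLex p.1 ≤ toLex p.2 := by
  have : DefPred L R fun p : (Fin k → R) × (Fin k → R) =>
      (∃ i, (∀ j, j < i → p.1 j = p.2 j) ∧ p.1 i < p.2 i) ∨ p.1 = p.2 :=
    .or (.finite_ex fun i => .and (.finite_all fun j => .imp (.const _)
      (.eq (by fun_prop) (by fun_prop))) (.lt (by fun_prop) (by fun_prop)))
      (.eq (by fun_prop) (by fun_prop))
  exact this.of_iff fun p => le_iff_lt_or_eq

/-- Let `W ⊆ R ^ k` be definable, such that over `U ⊆ R ^ d` the closure of `W` has finite fibres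
for the coordinate projection given by `σ`. Then `W` is relatively closed over a dense part of
`U`. -/
theorem not_hasInt_image_frontier (σ : Fin d → Fin k) {W : (Fin k → R) → Prop}
    (hW : DefPred L R W) {U : (Fin d → R) → Prop} (hU : DefPred L R U)
    (hfin : ∀ x, U x → {z | Cl W z ∧ (fun i => z (σ i)) = x}.Finite) :
    ¬ HasInt fun x => U x ∧ ∃ z, (Cl W z ∧ ¬ W z) ∧ (fun i => z (σ i)) = x := by
  intro hint
  let E : (Fin d → R) → (Fin k → R) → Prop := fun x z => (Cl W z ∧ ¬ W z) ∧ (fun i => z (σ i)) = x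
  have hE : DefPred L R fun p : (Fin d → R) × (Fin k → R) => E p.1 p.2 :=
    .and (.and (hW.cl.comp (by fun_prop)) (hW.not.comp (by fun_prop)))
      (.eq (by fun_prop) (by fun_prop))
  -- The lexicographic minimum of a finite fibre gives a definable choice `h` of a frontier point.
  let M : (Fin d → R) → (Fin k → R) → Prop := fun x z =>
    E x z ∧ ∀ z', E x z' → toLex z ≤ toLex z'
  have hM : DefPred L R fun p : (Fin d → R) × (Fin k → R) => M p.1 p.2 :=
    .and hE (.all (.imp (hE.comp (f := fun q : ((Fin d → R) × (Fin k → R)) × (Fin k → R) =>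
      (q.1.1, q.2)) (by fun_prop)) (DefPred.lexLE.comp
      (f := fun q : ((Fin d → R) × (Fin k → R)) × (Fin k → R) => (q.1.2, q.2)) (by fun_prop))))
  obtain ⟨h, hh, hhM⟩ := exists_defMap_of_unique hM fun x z z' hz hz' =>
    toLex.injective (le_antisymm (hz.2 _ hz'.1) (hz'.2 _ hz.1))
  have hhE : ∀ x, U x → (∃ z, E x z) → E x (h x) := fun x hx hz => by
    refine (hhM x ?_).1
    obtain ⟨z, hz, hmin⟩ := Set.exists_min_image {z | E x z} toLex
      ((hfin x hx).subset fun z hz => ⟨hz.1.1, hz.2⟩) hz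
    exact ⟨z, hz, hmin⟩
  -- The fibre of `W` over `x` is finite and omits `h x`, so it stays at positive distance from `h
  -- x`; on some cube this distance is uniform.
  let P : (Fin d → R) → R → Prop := fun x t =>
    (U x ∧ E x (h x)) ∧ ∀ w, W w → (fun i => w (σ i)) = x → ¬ Cube (h x) t w
  have hP : DefPred L R fun p : (Fin d → R) × R => P p.1 p.2 :=
    .and (.and (hU.comp (by fun_prop)) (hE.comp (f := fun p : (Fin d → R) × R => (p.1, h p.1))
      (by fun_prop))) (.all (.imp (hW.comp (by fun_prop)) (.imp (.eq (by fun_prop) (by fun_prop))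
        (.not (.cube (by fun_prop) (by fun_prop) (by fun_prop))))))
  obtain ⟨t, ht, hi⟩ := (baireProperty L R d).directed P hP
    (fun x s t _ hst hx => ⟨hx.1, fun w h1 h2 h3 => hx.2 w h1 h2 fun i => (h3 i).trans_le hst⟩)
    (hint.mono fun x hx => by
      have hEx := hhE x hx.1 hx.2
      obtain ⟨t, ht, h'⟩ := exists_cube_disjoint (S := {w | W w ∧ (fun i => w (σ i)) = x})
        ((hfin x hx.1).subset fun z hz => ⟨.of_mem hz.1, hz.2⟩) fun h => hEx.1.2 h.1
      exact ⟨t, ht, ⟨hx.1, hEx⟩, fun w h1 h2 => h' w ⟨h1, h2⟩⟩)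
  obtain ⟨v, c, r, hr, hv⟩ := (baireProperty L R d).exists_nearly_const_pi
    (hP.comp (f := fun x => (x, t)) (by fun_prop)) hi hh (show 0 < t / 8 by positivity)
  obtain ⟨⟨⟨-, hE0⟩, -⟩, hv0⟩ := hv c (.self c hr)
  -- A point of `W` near the frontier point over the centre `c`. The bound `r` keeps its projection
  -- in the cube. Three errors of at most `t / 8` (from `w` to `h c`, to `v`, to `h` at the
  -- projection of `w`) put `w` closer than `t` to the chosen frontier point of its own fibre, which
  -- is excluded.
  obtain ⟨w, hw, hcw⟩ := hE0.1.1 (min r (t / 8)) (lt_min hr (by positivity))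
  obtain ⟨⟨-, hPw⟩, hvw⟩ := hv (fun i => w (σ i)) fun i => by
    have := hcw (σ i)
    rw [congrFun hE0.2 i] at this
    exact this.trans_le (min_le_left _ _)
  refine hPw w hw rfl fun i => ?_
  have h1 := (hcw i).trans_le (min_le_right _ _)
  have h2 := hv0 i
  have h3 := hvw i
  rw [abs_lt] at h1 ⊢
  rw [abs_le] at h2 h3
  constructor <;> linarith

end Closure

/-! ### Types as ultrafilters of definable predicates. -/

section Holds

variable {L : FirstOrder.Language.{u, v}} {R : Type w} [L.Structure R] {n d : ℕ}

/-- The definable set given by a definable predicate. -/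
def DefPred.toDefSet {P : (Fin n → R) → Prop} (hP : DefPred L R P) : DefSet L R n := ⟨{x | P x}, hP⟩

theorem defPred_mem (V : DefSet L R n) : DefPred L R fun x : Fin n → R => x ∈ V := V.2

/-- The definable predicate `P` belongs to the type `p`. -/
def Holds (p : TypeOver L R n) (P : (Fin n → R) → Prop) : Prop :=
  ∃ hP : DefPred L R P, MemType hP.toDefSet p

variable [Nonempty R] {p q : TypeOver L R n} {P Q S : (Fin n → R) → Prop}

theorem Holds.of_imp (hP : Holds p P) (hQ : Holds p Q) (hS : DefPred L R S)
    (h : ∀ x, P x → Q x → S x) : Holds p S :=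
  ⟨hS, memType_of_inf_le hP.2 hQ.2 fun x hx => h x hx.1 hx.2⟩

theorem Holds.mono (hP : Holds p P) (hS : DefPred L R S) (h : ∀ x, P x → S x) : Holds p S :=
  hP.of_imp hP hS fun x hx _ => h x hx

theorem Holds.and (hP : Holds p P) (hQ : Holds p Q) : Holds p fun x => P x ∧ Q x :=
  hP.of_imp hQ (hP.1.and hQ.1) fun _ h h' => ⟨h, h'⟩

theorem Holds.exists (hP : Holds p P) : ∃ x, P x := by
  by_contra! h
  exact not_memType_bot p (memType_mono hP.2 fun x hx => (h x hx).elim)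

theorem Holds.not_of_not (hP : DefPred L R P) (h : ¬ Holds p P) : Holds p fun x => ¬ P x :=
  ⟨hP.not, memType_compl_of_not (V := hP.toDefSet) fun h' => h ⟨hP, h'⟩⟩

theorem Holds.true (p : TypeOver L R n) : Holds p fun _ => True := by
  by_contra h
  obtain ⟨x, hx⟩ := (Holds.not_of_not (.const _) h).exists
  exact hx trivial

theorem Holds.finite_all {ι : Type*} [Finite ι] {P : ι → (Fin n → R) → Prop}
    (h : ∀ i, Holds p (P i)) : Holds p fun x => ∀ i, P i x := by
  classical
  have := Fintype.ofFinite ι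
  suffices H : ∀ s : Finset ι, Holds p fun x => ∀ i ∈ s, P i x by simpa using H Finset.univ
  intro s
  induction s using Finset.induction_on with
  | empty => simpa using Holds.true p
  | insert i s _ ih => simpa using (h i).and ih

/-- One inclusion suffices, because complete types are maximal: a formula missing from `p` has its
negation in `p`. -/
theorem Holds.ext (h : ∀ V, Holds p V → Holds q V) : p = q := by
  have key : ∀ φ, φ ∈ p → φ ∈ q := by
    intro φ hφ
    obtain ⟨ψ, rfl⟩ := FirstOrder.Language.Formula.equivSentence.surjective φ
    obtain ⟨_, χ, hχ, hχq⟩ := h (fun x => ψ.Realize x) ⟨⟨ψ, rfl⟩, ψ, rfl, hφ⟩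
    refine formula_mem_of_imp q (fun x hx _ => ?_) hχq hχq
    have : x ∈ {x | χ.Realize x} := hx
    rw [← hχ] at this
    exact this
  refine SetLike.ext fun φ => ⟨key φ, fun hφ => ?_⟩
  by_contra hc
  exact (FirstOrder.Language.Theory.CompleteType.not_mem_iff q φ).1
    (key _ ((FirstOrder.Language.Theory.CompleteType.not_mem_iff p φ).2 hc)) hφ

end Holds

/-! ### Closed definable sets separate types. -/

section Separation

variable {L : FirstOrder.Language.{u, v}} {R : Type w} [L.Structure R]
  [Field R] [LinearOrder R] [IsStrictOrderedRing R] [IsOMinimal L R] [ExpandsOrderedField L R]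
  {n d : ℕ} {p q : TypeOver L R n}

/-- The projection of the type `p` to the coordinates given by `σ` is generic. -/
def IsGenericAlong (p : TypeOver L R n) (σ : Fin d → Fin n) : Prop :=
  ∀ S : (Fin d → R) → Prop, DefPred L R S → ¬ HasInt S → ¬ Holds p fun z => S fun i => z (σ i)

/-- A repeated coordinate would place the type on a diagonal, which has no interior. -/
theorem IsGenericAlong.injective {σ : Fin d → Fin n} (h : IsGenericAlong p σ) :
    Function.Injective σ := by
  intro i j hij
  by_contra hne
  refine h (fun x => x i = x j) (.eq (by fun_prop) (by fun_prop)) ?_ (by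
    simpa [hij] using Holds.true p)
  rintro ⟨c, r, hr, hc⟩
  have h1 : c i = c j := hc c (.self c hr)
  have h2 := hc (Function.update c i (c i + r / 2)) fun k => by
    by_cases hk : k = i
    · subst hk; simpa [abs_of_pos (half_pos hr)] using half_lt_self hr
    · simpa [hk] using hr
  simp only [Function.update_self, Function.update_of_ne (Ne.symm hne)] at h2
  linarith

/-- The empty family is generic, and injectivity bounds the length of a generic family by `n`. The
resulting `d` plays the role of the dimension of the type. -/
theorem exists_maximal_isGenericAlong (p : TypeOver L R n) :
    ∃ d, ∃ σ : Fin d → Fin n, IsGenericAlong p σ ∧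
      ∀ σ' : Fin (d + 1) → Fin n, ¬ IsGenericAlong p σ' := by
  by_contra! hc
  have H : ∀ d, ∃ σ : Fin d → Fin n, IsGenericAlong p σ := by
    intro d
    induction d with
    | zero =>
      refine ⟨Fin.elim0, fun S _ hS hp => ?_⟩
      obtain ⟨z, hz⟩ := hp.exists
      exact hS ⟨fun i => i.elim0, 1, one_pos, fun w _ => Subsingleton.elim _ w ▸ hz⟩
    | succ d ih =>
      obtain ⟨σ, hσ⟩ := ih
      exact hc d σ hσ
  obtain ⟨σ, hσ⟩ := H (n + 1)
  have := Fintype.card_le_of_injective σ hσ.injective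
  simp at this

theorem Cl.comp {k : ℕ} (σ : Fin d → Fin k) {C : (Fin d → R) → Prop} {z : Fin k → R}
    (hz : Cl (fun z => C fun i => z (σ i)) z) : Cl C fun i => z (σ i) := fun r hr =>
  (hz r hr).elim fun _ hw => ⟨_, hw.1, fun i => hw.2 (σ i)⟩

theorem not_hasInt_exists {ι : Type*} [Finite ι] {P : ι → (Fin d → R) → Prop}
    (hP : ∀ i, DefPred L R (P i)) (h : ∀ i, ¬ HasInt (P i)) : ¬ HasInt fun x => ∃ i, P i x := by
  classical
  have := Fintype.ofFinite ι
  suffices H : ∀ s : Finset ι, ¬ HasInt fun x => ∃ i ∈ s, P i x by simpa using H Finset.univ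
  intro s
  induction s using Finset.induction_on with
  | empty => exact fun h => by simpa using h.exists
  | insert i s _ ih =>
    intro hi
    simp only [Finset.exists_mem_insert] at hi
    refine ((baireProperty L R d).union _ _ (hP i) ?_ hi).elim (h i) ih
    exact (DefPred.finite_ex fun i : s => hP i).of_iff (by simp)

/-- Two types which contain the same closed definable sets are equal. -/
theorem eq_of_holds_closed_iff (h : ∀ C : (Fin n → R) → Prop, DefPred L R C →
    (∀ z, Cl C z → C z) → (Holds p C ↔ Holds q C)) : p = q := by
  refine Holds.ext fun V hV => ?_
  -- The preimage of a closed set under a coordinate projection is closed, so the hypothesis applies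
  -- to it.
  have hcomp : ∀ {m : ℕ} (τ : Fin m → Fin n) {C : (Fin m → R) → Prop}, DefPred L R C →
      (Holds p (fun z => Cl C fun i => z (τ i)) ↔ Holds q fun z => Cl C fun i => z (τ i)) :=
    fun τ C hC => h _ (hC.cl.comp (by fun_prop)) fun z hz => Cl.idem (Cl.comp τ hz)
  obtain ⟨d, σ, hσ, hmax⟩ := exists_maximal_isGenericAlong p
  have hB := baireProperty L R d
  -- By maximality each further coordinate is dependent: together with the generic ones it lies in a
  -- set without interior.
  have hS : ∀ j : Fin n, ∃ S : (Fin (d + 1) → R) → Prop, DefPred L R S ∧ ¬ HasInt S ∧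
      Holds p fun z => S fun i => z ((Fin.cons j σ : Fin (d + 1) → Fin n) i) := by
    intro j
    by_contra! hc
    exact hmax _ fun S h1 h2 => hc S h1 h2
  choose S hS hSi hSp using hS
  have hcons : ∀ j (z : Fin n → R), (fun i => z ((Fin.cons j σ : Fin (d + 1) → Fin n) i)) =
      Fin.cons (z j) fun i => z (σ i) := by
    intro j z
    funext i
    cases i using Fin.cases <;> simp
  -- The base points where the dependence of coordinate `j` degenerates. They have no interior,
  -- since otherwise `Cl (S j)`, hence `S j`, would.
  let T : Fin n → (Fin d → R) → Prop := fun j x =>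
    ∃ a b, a < b ∧ ∀ y, a < y → y < b → Cl (S j) (Fin.cons y x)
  have hT : ∀ j, DefPred L R (T j) := fun j =>
    .ex (.ex (.and (.lt (by fun_prop) (by fun_prop)) (.all (.imp (.lt (by fun_prop) (by fun_prop))
      (.imp (.lt (by fun_prop) (by fun_prop)) ((hS j).cl.comp
        (.finCons (by fun_prop) (by fun_prop))))))))
  have hTi : ∀ j, ¬ HasInt (T j) := fun j hj =>
    hSi j ((hB.hasInt_of_fibres (hS j).cl hj).of_cl (hS j))
  let N : (Fin d → R) → Prop := fun x => ∃ j, T j x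
  have hN : DefPred L R N := .finite_ex hT
  have hNi : ¬ HasInt (Cl N) := fun hi => not_hasInt_exists hT hTi (hi.of_cl hN)
  have hNp := hσ _ hN.cl hNi
  have hNq : Holds q fun z => ¬ Cl N fun i => z (σ i) :=
    .not_of_not (hN.cl.comp (by fun_prop)) (mt (hcomp σ hN).2 hNp)
  let G : (Fin n → R) → Prop := fun z => (¬ Cl N fun i => z (σ i)) ∧
    ∀ j, Cl (S j) fun i => z ((Fin.cons j σ : Fin (d + 1) → Fin n) i)
  have hG : Holds p G := (Holds.not_of_not (hN.cl.comp (by fun_prop)) hNp).and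
    (.finite_all fun j => (hSp j).mono ((hS j).cl.comp (by fun_prop)) fun _ => .of_mem)
  let W : (Fin n → R) → Prop := fun z => V z ∧ G z
  have hW : Holds p W := hV.and hG
  -- Off `Cl N` each coordinate of a point in the fibre has only finitely many possible values,
  -- since an infinite set of them would contain an interval.
  have hfin : ∀ x, ¬ Cl N x → {z | Cl W z ∧ (fun i => z (σ i)) = x}.Finite := by
    intro x hx
    refine (Set.Finite.pi' (t := fun j => {y | Cl (S j) (Fin.cons y x)}) fun j => ?_).subset ?_
    · by_contra hinf
      exact hx (.of_mem ⟨j, DefPred.exists_interval (L := L)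
        ((hS j).cl.comp (.finCons (by fun_prop) (by fun_prop))) hinf⟩)
    · rintro z ⟨hz, rfl⟩ j
      rw [mem_ofPred_eq, ← hcons]
      exact Cl.idem (Cl.comp _ (hz.mono fun z hz => hz.2.2 j))
  let D : (Fin d → R) → Prop := fun x =>
    (¬ Cl N x) ∧ ∃ z, (Cl W z ∧ ¬ W z) ∧ (fun i => z (σ i)) = x
  have hD : DefPred L R D := .and hN.cl.not (.ex (.and (.and (hW.1.cl.comp (by fun_prop))
    (hW.1.not.comp (by fun_prop))) (.eq (by fun_prop) (by fun_prop))))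
  have hDi : ¬ HasInt (Cl D) := fun hi =>
    not_hasInt_image_frontier σ hW.1 hN.cl.not hfin (hi.of_cl hD)
  have hDq : Holds q fun z => ¬ Cl D fun i => z (σ i) :=
    .not_of_not (hD.cl.comp (by fun_prop)) (mt (hcomp σ hD).2 (hσ _ hD.cl hDi))
  have hWq : Holds q (Cl W) := (h _ hW.1.cl fun _ => Cl.idem).1 (hW.mono hW.1.cl fun _ => .of_mem)
  -- All three conditions held by `q` were obtained by comparing closed sets with `p`; off `Cl N`
  -- and `Cl D`, a point of the closure of `W` is already in `W`, hence in `V`.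
  refine (hNq.and hDq).of_imp hWq hV.1 fun z hz hWz => ?_
  by_contra hVz
  exact hz.2 (.of_mem ⟨hz.1, z, ⟨hWz, fun hw => hVz hw.1⟩, rfl⟩)

end Separation

/-! ### Compactness for families of definable sets. -/

section Compactness

variable {L : FirstOrder.Language.{u, v}} {R : Type w} [L.Structure R] [Nonempty R] {n : ℕ}

/-- A family of definable sets with the finite intersection property is contained in a complete
type. -/
theorem exists_typeOver_of_finite_inter {ι : Type*} (V : ι → DefSet L R n)
    (h : ∀ s : Finset ι, ∃ x : Fin n → R, ∀ i ∈ s, x ∈ V i) :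
    ∃ p : TypeOver L R n, ∀ i, MemType (V i) p := by
  classical
  have hφ : ∀ i, ∃ φ : L[[(univ : Set R)]].Formula (Fin n), ∀ x, x ∈ V i ↔ φ.Realize x := fun i => by
    obtain ⟨φ, hφ⟩ := (V i).2
    refine ⟨φ, fun x => ?_⟩
    have : x ∈ (V i).1 ↔ x ∈ {x | φ.Realize x} := by rw [hφ]
    exact this
  choose φ hφ using hφ
  let f : ι → L[[(univ : Set R)]][[Fin n]].Sentence := fun i =>
    FirstOrder.Language.Formula.equivSentence (φ i)
  suffices H : {p : TypeOver L R n | range f ⊆ (p : L[[(univ : Set R)]][[Fin n]].Theory)} ≠ ∅ by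
    obtain ⟨p, hp⟩ := nonempty_iff_ne_empty.2 H
    exact ⟨p, fun i => ⟨φ i, Set.ext fun x => hφ i x, hp ⟨i, rfl⟩⟩⟩
  rw [Ne, FirstOrder.Language.Theory.CompleteType.setOfPred_subset_eq_empty_iff, not_not,
    FirstOrder.Language.Theory.isSatisfiable_iff_isFinitelySatisfiable]
  intro T₀ hT₀
  obtain ⟨s, hs⟩ : ∃ s : Finset ι, s.image f = T₀.filter (· ∈ range f) := by
    obtain ⟨s, -, hs⟩ := Finset.subset_set_image_iff.1
      (show ((T₀.filter (· ∈ range f) : Finset _) : Set _) ⊆ f '' univ by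
        intro ψ hψ
        simpa using (Finset.mem_filter.1 (Finset.mem_coe.1 hψ)).2)
    exact ⟨s, hs⟩
  obtain ⟨x, hx⟩ := h s
  -- The type of a common point of the finitely many sets involved contains the finite theory, and
  -- so shows it satisfiable.
  let q : TypeOver L R n := (L[[(univ : Set R)]].completeTheory R).typeOf x
  refine q.isMaximal.1.mono fun ψ hψ => ?_
  rcases hT₀ hψ with h1 | h1
  · exact q.subset h1
  · have : ψ ∈ s.image f := hs ▸ Finset.mem_filter.2 ⟨hψ, h1⟩
    obtain ⟨i, hi, rfl⟩ := Finset.mem_image.1 this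
    exact FirstOrder.Language.Theory.CompleteType.formula_mem_typeOf.2 ((hφ i x).1 (hx i hi))

end Compactness

/-! ### Continuous definable functions: units, the Gelfand property, zero sets. -/

section Ring

variable {L : FirstOrder.Language.{u, v}} {R : Type w} [L.Structure R]
  [Field R] [LinearOrder R] [IsStrictOrderedRing R] [TopologicalSpace R] [OrderTopology R]
  [ExpandsOrderedField L R] {n : ℕ} {X : DefSet L R n}

/-- The restriction to `X` of a definable function on `R ^ n` which is continuous on `X`. -/
def ofDefMap (X : DefSet L R n) {F : (Fin n → R) → R} (hF : DefMap L R F)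
    (hc : Continuous fun x : X => F x) : definableContinuous X where
  val := ⟨_, hc⟩
  property := by
    have : DefPred L R fun y : Fin (n + 1) → R => (fun i : Fin n => y i.castSucc) ∈ X ∧
        F (fun i => y i.castSucc) = y (Fin.last n) :=
      .and ((defPred_mem X).comp (by fun_prop)) (.eq (hF.comp (by fun_prop)) (by fun_prop))
    exact this.of_iff fun y => exists_prop

@[simp]
theorem ofDefMap_apply {F : (Fin n → R) → R} (hF : DefMap L R F)
    (hc : Continuous fun x : X => F x) (x : X) : (ofDefMap X hF hc).1 x = F x := rfl

theorem exists_defMap_extension (f : definableContinuous X) :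
    ∃ F : (Fin n → R) → R, DefMap L R F ∧ ∀ x : X, f.1 x = F x := by
  have hf : DefPred L R fun y : Fin (n + 1) → R =>
    ∃ h : Fin.init y ∈ X, f.1 ⟨Fin.init y, h⟩ = y (Fin.last n) := f.2
  have hs : DefMap L R fun p : (Fin n → R) × R => (Fin.snoc p.1 p.2 : Fin (n + 1) → R) :=
    .pi fun i => by
      cases i using Fin.lastCases
      · simp only [Fin.snoc_last]; fun_prop
      · simp only [Fin.snoc_castSucc]; fun_prop
  obtain ⟨F, hF, hFH⟩ := exists_defMap_of_unique (L := L) (R := R)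
    (H := fun x y => ∃ h : x ∈ X, f.1 ⟨x, h⟩ = y) ((hf.comp hs).of_iff fun p => by simp)
    (by rintro x y y' ⟨_, rfl⟩ ⟨_, rfl⟩; rfl)
  exact ⟨F, hF, fun x => (hFH x ⟨_, x.2, rfl⟩).2⟩

theorem DefMap.inv {F : (Fin n → R) → R} (hF : DefMap L R F) : DefMap L R fun x => (F x)⁻¹ := by
  refine .of_graph ?_
  have : DefPred L R fun p : (Fin n → R) × R =>
      (F p.1 = 0 ∧ p.2 = 0) ∨ F p.1 * p.2 = 1 :=
    .or (.and (.eq (by fun_prop) (by fun_prop)) (.eq (by fun_prop) (by fun_prop)))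
      (.eq (by fun_prop) (by fun_prop))
  refine this.of_iff fun p => ?_
  by_cases h : F p.1 = 0
  · simp [h, eq_comm]
  · simp only [h, false_and, false_or]
    exact ⟨fun hp => hp ▸ mul_inv_cancel₀ h, fun hp => (eq_inv_of_mul_eq_one_right hp).symm⟩

theorem isUnit_of_forall_ne_zero (f : definableContinuous X) (hf : ∀ x, f.1 x ≠ 0) : IsUnit f := by
  obtain ⟨F, hF, hfF⟩ := exists_defMap_extension f
  have hc : Continuous fun x : X => (F x)⁻¹ := by
    simp only [← hfF]
    exact f.1.continuous.inv₀ hf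
  refine IsUnit.of_mul_eq_one (ofDefMap X hF.inv hc) (Subtype.ext (ContinuousMap.ext fun x => ?_))
  have := hf x
  rw [hfF] at this
  simp [hfF, this]

theorem isCoprime_of_disjoint (f g : definableContinuous X) (h : ∀ x, f.1 x = 0 → g.1 x ≠ 0) :
    IsCoprime f g := by
  have hu : IsUnit (f * f + g * g) := isUnit_of_forall_ne_zero _ fun x hx => by
    have hx' : f.1 x * f.1 x + g.1 x * g.1 x = 0 := hx
    rw [mul_self_add_mul_self_eq_zero] at hx'
    exact h x hx'.1 hx'.2
  obtain ⟨a, ha⟩ := hu.exists_left_inv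
  exact ⟨a * f, a * g, by rw [← ha]; ring⟩

/-- The ring of continuous definable functions is a Gelfand ring. -/
theorem exists_mul_eq_zero_isCoprime (f g : definableContinuous X) (h : f + g = 1) :
    ∃ u v : definableContinuous X, u * v = 0 ∧ IsCoprime u g ∧ IsCoprime v f := by
  obtain ⟨F, hF, hfF⟩ := exists_defMap_extension f
  obtain ⟨G, hG, hgG⟩ := exists_defMap_extension g
  have hFc : Continuous fun x : X => F x := by simpa only [← hfF] using f.1.continuous
  have hGc : Continuous fun x : X => G x := by simpa only [← hgG] using g.1.continuous
  have hFG : ∀ x : X, F x + G x = 1 := fun x => by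
    rw [← hfF, ← hgG]
    exact congrArg (fun k : definableContinuous X => k.1 x) h
  -- The positive and negative parts of `f² - g²`. Where `g = 0` one has `f = 1`, so the first
  -- equals `1`; symmetrically for the second.
  refine ⟨ofDefMap X (F := fun x => max (F x * F x - G x * G x) 0) (by fun_prop)
      (((hFc.mul hFc).sub (hGc.mul hGc)).max continuous_const),
    ofDefMap X (F := fun x => max (G x * G x - F x * F x) 0) (by fun_prop)
      (((hGc.mul hGc).sub (hFc.mul hFc)).max continuous_const),
    Subtype.ext (ContinuousMap.ext fun x => ?_), isCoprime_of_disjoint _ _ fun x hx hx' => ?_,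
    isCoprime_of_disjoint _ _ fun x hx hx' => ?_⟩
  · change max (F x * F x - G x * G x) 0 * max (G x * G x - F x * F x) 0 = 0
    rcases le_total (F x * F x) (G x * G x) with h | h
    · rw [max_eq_right (sub_nonpos.2 h), zero_mul]
    · rw [max_eq_right (sub_nonpos.2 h), mul_zero]
  · rw [ofDefMap_apply, max_eq_right_iff] at hx
    rw [hgG] at hx'
    have h1 := hFG x
    rw [hx'] at hx h1
    rw [add_zero] at h1
    rw [h1] at hx
    norm_num at hx
  · rw [ofDefMap_apply, max_eq_right_iff] at hx
    rw [hfF] at hx'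
    have h1 := hFG x
    rw [hx'] at hx h1
    rw [zero_add] at h1
    rw [h1] at hx
    norm_num at hx

theorem Cube.exists_subset {O : Set (Fin n → R)} (hO : IsOpen O) {x : Fin n → R} (hx : x ∈ O) :
    ∃ r, 0 < r ∧ ∀ w, Cube x r w → w ∈ O := by
  obtain ⟨U, hU, hUO⟩ := isOpen_pi_iff'.1 hO x hx
  have hε : ∀ i, ∃ ε, 0 < ε ∧ ∀ y, |y - x i| < ε → y ∈ U i := fun i =>
    (nhds_basis_abs_sub_lt (x i)).mem_iff.1 ((hU i).1.mem_nhds (hU i).2)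
  choose ε hε hεU using hε
  rcases isEmpty_or_nonempty (Fin n) with he | he
  · exact ⟨1, one_pos, fun w _ => hUO fun i _ => he.elim i⟩
  · obtain ⟨j, hj⟩ := Finite.exists_min ε
    exact ⟨ε j, hε j, fun w hw => hUO fun i _ => hεU i _ ((hw i).trans_le (hj i))⟩

/-- The one-sided estimate is enough, because `Cube x δ y` is symmetric in `x` and `y`; it makes `F`
1-Lipschitz for the sup norm. -/
theorem continuous_of_cube {F : (Fin n → R) → R}
    (hF : ∀ δ, 0 < δ → ∀ x y, Cube x δ y → F x - δ ≤ F y) : Continuous F := by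
  refine continuous_iff_continuousAt.2 fun x =>
    LinearOrderedAddCommGroup.tendsto_nhds.2 fun ε hε => ?_
  have h : ∀ᶠ y in 𝓝 x, Cube x (ε / 2) y := Filter.eventually_all.2 fun i =>
    (continuous_apply i).continuousAt.eventually (eventually_abs_sub_lt (x i) (half_pos hε))
  filter_upwards [h] with y hy
  have h1 := hF _ (half_pos hε) x y hy
  have h2 := hF _ (half_pos hε) y x fun i => by rw [abs_sub_comm]; exact hy i
  rw [abs_lt]
  constructor <;> linarith

variable [IsOMinimal L R]

/-- The closure of a definable set is the zero set of a continuous definable function. -/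
theorem exists_zero_iff_cl (X : DefSet L R n) {K : (Fin n → R) → Prop} (hK : DefPred L R K) :
    ∃ f : definableContinuous X, ∀ x : X, f.1 x = 0 ↔ Cl K x := by
  -- The supremum of these `t` is the sup-norm distance to `K` truncated at `1`. Allowing `t = 0`
  -- makes the set nonempty, and the truncation bounds it even when `K` is empty.
  let A : (Fin n → R) → R → Prop := fun x t =>
    0 ≤ t ∧ t ≤ 1 ∧ (0 < t → ∀ w, K w → ¬ Cube x t w)
  have hA : DefPred L R fun p : (Fin n → R) × R => A p.1 p.2 :=
    .and (.le (by fun_prop) (by fun_prop)) (.and (.le (by fun_prop) (by fun_prop))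
      (.imp (.lt (by fun_prop) (by fun_prop)) (.all (.imp (hK.comp (by fun_prop))
        (.not (.cube (by fun_prop) (by fun_prop) (by fun_prop)))))))
  have hA0 : ∀ x, A x 0 := fun x => ⟨le_rfl, zero_le_one, fun h => (lt_irrefl _ h).elim⟩
  obtain ⟨F, hF, hFA⟩ := exists_defMap_of_unique (L := L)
    (H := fun (x : Fin n → R) (c : R) => IsLUB {t | A x t} c) (.isLUB hA) fun x c c' => IsLUB.unique
  have hlub : ∀ x, IsLUB {t | A x t} (F x) := fun x => hFA x <|
    DefPred.exists_isLUB (L := L) (P := A x) (hA.comp (f := fun t => (x, t)) (by fun_prop))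
      ⟨0, hA0 x⟩ ⟨1, fun t ht => ht.2.1⟩
  have hc : Continuous F := continuous_of_cube fun δ hδ x y hxy => by
    rw [sub_le_iff_le_add]
    refine (hlub x).2 fun t ht => ?_
    rw [← sub_le_iff_le_add]
    rcases le_or_gt (t - δ) 0 with h | h
    · exact h.trans ((hlub y).1 (hA0 y))
    · refine (hlub y).1 ⟨h.le, by linarith [ht.2.1], fun _ w hw hyw =>
        ht.2.2 (by linarith) w hw fun i => ?_⟩
      have h1 := abs_lt.1 (hyw i)
      have h2 := abs_lt.1 (hxy i)
      rw [abs_lt]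
      constructor <;> linarith
  refine ⟨ofDefMap X hF (hc.comp continuous_subtype_val), fun x => ?_⟩
  rw [ofDefMap_apply]
  constructor
  · intro h0 r hr
    by_contra! hcon
    have hm : 0 < min r 1 := lt_min hr one_pos
    have : A x (min r 1) := ⟨hm.le, min_le_right _ _, fun _ w hw hxw =>
      hcon w hw fun i => (hxw i).trans_le (min_le_left _ _)⟩
    have := (hlub x).1 this
    rw [h0] at this
    exact hm.not_ge this
  · intro hx
    refine le_antisymm ((hlub x).2 fun t ht => ?_) ((hlub x).1 (hA0 x))
    by_contra! h
    obtain ⟨w, hw, hxw⟩ := hx t h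
    exact ht.2.2 h w hw hxw

end Ring

/-! ### Gelfand rings. -/

section Gelfand

variable {A : Type*} [CommRing A]

/-- In a Gelfand ring every prime ideal lies in a unique maximal ideal, and this defines a
continuous retraction of the prime spectrum onto the maximal spectrum. -/
theorem exists_isClosedPointRetraction_primeSpectrum
    (hA : ∀ f g : A, f + g = 1 → ∃ u v, u * v = 0 ∧ IsCoprime u g ∧ IsCoprime v f) :
    ∃ r : PrimeSpectrum A → MaximalSpectrum A,
      IsClosedPointRetraction MaximalSpectrum.toPrimeSpectrum r := by
  have hcop : ∀ (m : MaximalSpectrum A) (u g : A), IsCoprime u g → g ∈ m.asIdeal →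
      u ∉ m.asIdeal := by
    rintro m u g ⟨a, b, hab⟩ hg hu
    refine m.isMaximal.ne_top ((Ideal.eq_top_iff_one _).2 ?_)
    rw [← hab]
    exact Ideal.add_mem _ (Ideal.mul_mem_left _ _ hu) (Ideal.mul_mem_left _ _ hg)
  have hex : ∀ x : PrimeSpectrum A, ∃ m : MaximalSpectrum A, x.asIdeal ≤ m.asIdeal := fun x => by
    obtain ⟨M, hM, hxM⟩ := Ideal.exists_le_maximal x.asIdeal x.isPrime.ne_top
    exact ⟨⟨M, hM⟩, hxM⟩
  choose r hr using hex
  have huniq : ∀ (x : PrimeSpectrum A) (m : MaximalSpectrum A), x.asIdeal ≤ m.asIdeal → m = r x := by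
    intro x m hm
    by_contra hne
    have hne' : m.asIdeal ≠ (r x).asIdeal := fun h => hne (MaximalSpectrum.ext h)
    obtain ⟨f, hf, g, hg, hfg⟩ := Submodule.mem_sup.1
      ((Ideal.eq_top_iff_one _).1 (m.isMaximal.coprime_of_ne (r x).isMaximal hne'))
    obtain ⟨u, v, huv, hug, hvf⟩ := hA f g hfg
    rcases x.isPrime.mem_or_mem (show u * v ∈ x.asIdeal by simp [huv]) with h | h
    · exact hcop _ _ _ hug hg (hr x h)
    · exact hcop _ _ _ hvf hf (hm h)
  refine ⟨r, ?_, fun m => (huniq _ _ le_rfl).symm, fun x m => ?_⟩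
  · refine continuous_induced_rng.2
      (PrimeSpectrum.isTopologicalBasis_basic_opens.continuous_iff.2 ?_)
    rintro _ ⟨f, rfl⟩
    refine isOpen_iff_forall_mem_open.2 fun x hx => ?_
    have hfx : f ∉ (r x).asIdeal := hx
    -- The open set where `u` is not in the prime is the required neighbourhood of `x`: `u` avoids
    -- `r x`, and for primes `y` omitting `u` the relation `u * v = 0` puts `v`, which is coprime to
    -- `a * f`, into `r y`, so `f` cannot be there.
    obtain ⟨a, g, hg, hag⟩ := (r x).isMaximal.exists_inv hfx
    obtain ⟨u, v, huv, hug, hvf⟩ := hA (a * f) g hag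
    refine ⟨PrimeSpectrum.basicOpen u, fun y hy => ?_, (PrimeSpectrum.basicOpen u).2,
      fun hux => hcop _ _ _ hug hg (hr x hux)⟩
    have hvy : v ∈ y.asIdeal :=
      (y.isPrime.mem_or_mem (show u * v ∈ y.asIdeal by simp [huv])).resolve_left hy
    exact fun hfy => hcop _ _ _ hvf (Ideal.mul_mem_left _ a hfy) (hr y hvy)
  · rw [← PrimeSpectrum.le_iff_mem_closure]
    refine ⟨huniq x m, ?_⟩
    rintro rfl
    exact hr x

end Gelfand

/-! ### The map `iota` and its restriction to closed points. -/

section Main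

variable {L : FirstOrder.Language.{u, v}} {R : Type w} [L.Structure R]
  [Field R] [LinearOrder R] [IsStrictOrderedRing R] [TopologicalSpace R] [OrderTopology R]
  [ExpandsOrderedField L R] [IsOMinimal L R] {n : ℕ} {X : DefSet L R n}

theorem mem_iota {f : definableContinuous X} {p : OMinSpectrum X} :
    f ∈ (iota X p).asIdeal ↔ MemType (zeroSet f) p.toType := Iff.rfl

/-- A closed definable set meets `X` in a zero set, so the ideal records which closed sets belong to
the type. -/
theorem iota_injective : Function.Injective (iota X) := by
  intro p q hpq
  have key : ∀ p q : OMinSpectrum X, iota X p = iota X q → ∀ C : (Fin n → R) → Prop,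
      DefPred L R C → (∀ z, Cl C z → C z) → Holds p.toType C → Holds q.toType C := by
    intro p q hpq C hC hcl hp
    obtain ⟨f, hf⟩ := exists_zero_iff_cl X hC
    have hfp : f ∈ (iota X p).asIdeal := mem_iota.2 <| memType_of_inf_le p.mem hp.2
      fun x hx => ⟨hx.1, (hf ⟨x, hx.1⟩).2 (.of_mem hx.2)⟩
    rw [hpq] at hfp
    exact ⟨hC, memType_mono (mem_iota.1 hfp) fun x ⟨h, hx⟩ => hcl _ ((hf ⟨x, h⟩).1 hx)⟩
  have h := eq_of_holds_closed_iff (p := p.toType) (q := q.toType) fun C hC hcl =>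
    ⟨key p q hpq C hC hcl, key q p hpq.symm C hC hcl⟩
  cases p; cases q; cases h; rfl

theorem memType_sdiff_iff {p : OMinSpectrum X} {V : DefSet L R n} :
    MemType (X \ V) p.toType ↔ ¬ MemType V p.toType :=
  ⟨fun h hV => not_memType_bot p.toType (memType_of_inf_le h hV fun _ hx => hx.1.2 hx.2),
    fun h => memType_of_inf_le p.mem (memType_compl_of_not h) fun _ hx => hx⟩

/-- The definable open subsets of `X` are exactly the complements of zero sets, so the two
generating families of open sets coincide. -/
theorem isInducing_iota : IsInducing (iota X) := by
  refine ⟨?_⟩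
  rw [PrimeSpectrum.isTopologicalBasis_basic_opens.eq_generateFrom, induced_generateFrom_eq]
  refine congrArg TopologicalSpace.generateFrom (Set.ext fun B => ?_)
  constructor
  · rintro ⟨U, hUX, ⟨O, hO, hUO⟩, rfl⟩
    have hmem : ∀ x, x ∈ U ↔ x ∈ O ∧ x ∈ X := fun x => by
      rw [← SetLike.mem_coe, hUO]; rfl
    obtain ⟨f, hf⟩ := exists_zero_iff_cl X (defPred_mem (X \ U))
    refine ⟨_, ⟨f, rfl⟩, Set.ext fun p => ?_⟩
    have hz : U = X \ zeroSet f := by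
      have h1 : ∀ x ∈ U, x ∉ zeroSet f := by
        rintro x hx ⟨h, hfx⟩
        obtain ⟨r, hr, hrO⟩ := Cube.exists_subset hO ((hmem x).1 hx).1
        obtain ⟨w, hw, hxw⟩ := (hf ⟨x, h⟩).1 hfx r hr
        exact hw.2 ((hmem w).2 ⟨hrO w hxw, hw.1⟩)
      have h2 : ∀ x ∈ X, x ∉ zeroSet f → x ∈ U := by
        intro x hx hfx
        by_contra hxU
        exact hfx ⟨hx, (hf ⟨x, hx⟩).2 (.of_mem ⟨hx, hxU⟩)⟩
      exact le_antisymm (fun x hx => ⟨hUX hx, h1 x hx⟩) fun x hx => h2 x hx.1 hx.2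
    change ¬ MemType (zeroSet f) p.toType ↔ MemType U p.toType
    rw [hz, memType_sdiff_iff]
  · rintro ⟨_, ⟨f, rfl⟩, rfl⟩
    obtain ⟨O, hO, hfO⟩ := isOpen_induced_iff.1
      (isOpen_compl_singleton.preimage f.1.continuous : IsOpen (f.1 ⁻¹' {0}ᶜ))
    refine ⟨X \ zeroSet f, fun x hx => hx.1, ⟨O, hO, Set.ext fun x => ?_⟩,
      Set.ext fun p => memType_sdiff_iff.symm⟩
    have hx : ∀ h : x ∈ X, x ∈ O ↔ f.1 ⟨x, h⟩ ≠ 0 := fun h => by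
      have := Set.ext_iff.1 hfO ⟨x, h⟩
      exact this
    exact ⟨fun h => ⟨(hx h.1).2 fun h0 => h.2 ⟨h.1, h0⟩, h.1⟩,
      fun h => ⟨h.2, fun ⟨_, h0⟩ => (hx h.2).1 h.1 h0⟩⟩

theorem exists_iota_eq (m : MaximalSpectrum (definableContinuous X)) :
    ∃ p, iota X p = m.toPrimeSpectrum := by
  obtain ⟨p, hp⟩ := exists_typeOver_of_finite_inter
    (fun f : m.asIdeal => zeroSet (f : definableContinuous X)) (fun s => by
      -- In an ordered field a sum of squares vanishes only where every term does, so a zero of this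
      -- non-unit is a common zero.
      have hmem : ∑ f ∈ s, (f : definableContinuous X) * f ∈ m.asIdeal :=
        Ideal.sum_mem _ fun f _ => Ideal.mul_mem_left _ _ f.2
      have hnu : ¬ IsUnit (∑ f ∈ s, (f : definableContinuous X) * f) := fun hu =>
        m.isMaximal.ne_top (Ideal.eq_top_of_isUnit_mem _ hmem hu)
      obtain ⟨x, hx⟩ : ∃ x, (∑ f ∈ s, (f : definableContinuous X) * f).1 x = 0 := by
        by_contra! h
        exact hnu (isUnit_of_forall_ne_zero _ h)
      have hx' : ∑ f ∈ s, f.1.1 x * f.1.1 x = 0 := by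
        rw [← hx]
        simp
      refine ⟨x, fun f hf => ⟨x.2, ?_⟩⟩
      exact mul_self_eq_zero.1
        ((Finset.sum_eq_zero_iff_of_nonneg fun f _ => mul_self_nonneg (f.1.1 x)).1 hx' f hf))
  -- The zero set of the function `0` is `X`, so the type concentrates on `X`.
  let q : OMinSpectrum X := ⟨p, memType_mono (hp 0) fun x hx => hx.1⟩
  refine ⟨q, PrimeSpectrum.ext ?_⟩
  exact (m.isMaximal.eq_of_le (iota X q).isPrime.ne_top fun f hf => hp ⟨f, hf⟩).symm

theorem iota_mem_closure_iff {p q : OMinSpectrum X} :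
    q ∈ closure {p} ↔ iota X q ∈ closure {iota X p} := by
  rw [isInducing_iota.closure_eq_preimage_closure_image, image_singleton, mem_preimage]

/-- A maximal ideal above `iota X p` is `iota X q` for some `q` in the closure of `p`, and a closed
`p` forces `q = p`. Conversely, the point is the preimage of a closed point under an injective
continuous map. -/
theorem isClosed_singleton_iff_isMaximal_iota (p : OMinSpectrum X) :
    IsClosed ({p} : Set (OMinSpectrum X)) ↔ (iota X p).asIdeal.IsMaximal := by
  rw [← PrimeSpectrum.isClosed_singleton_iff_isMaximal]
  constructor
  · intro hp
    obtain ⟨M, hM, hpM⟩ := Ideal.exists_le_maximal _ (iota X p).isPrime.ne_top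
    obtain ⟨q, hq⟩ := exists_iota_eq (X := X) ⟨M, hM⟩
    have hqp : q ∈ closure {p} := by
      rw [iota_mem_closure_iff, ← PrimeSpectrum.le_iff_mem_closure, hq]
      exact hpM
    rw [hp.closure_eq, mem_singleton_iff] at hqp
    rw [← hqp, hq]
    exact (PrimeSpectrum.isClosed_singleton_iff_isMaximal _).2 hM
  · intro hp
    have := hp.preimage isInducing_iota.continuous
    rwa [← image_singleton, preimage_image_eq _ iota_injective] at this

variable (X) in
/-- The restriction of `ι` to closed points. -/
def iotaClosed (p : ClosedPoints (OMinSpectrum X)) : MaximalSpectrum (definableContinuous X) :=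
  ⟨(iota X p.1).asIdeal, (isClosed_singleton_iff_isMaximal_iota p.1).1 p.2⟩

theorem iotaClosed_bijective : Function.Bijective (iotaClosed X) := by
  constructor
  · intro p q h
    exact Subtype.ext (iota_injective (congrArg MaximalSpectrum.toPrimeSpectrum h))
  · intro m
    obtain ⟨p, hp⟩ := exists_iota_eq m
    refine ⟨⟨p, (isClosed_singleton_iff_isMaximal_iota p).2 ?_⟩, MaximalSpectrum.ext ?_⟩
    · rw [hp]; exact m.isMaximal
    · exact congrArg PrimeSpectrum.asIdeal hp

theorem isInducing_iotaClosed : IsInducing (iotaClosed X) :=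
  (IsInducing.of_comp_iff (g := MaximalSpectrum.toPrimeSpectrum) ⟨rfl⟩).1
    (isInducing_iota.comp IsInducing.subtypeVal)

end Main

end OMin

theorem mainTheorem7 {L : FirstOrder.Language.{u, v}} {R : Type w} [Field R] [LinearOrder R]
    [IsStrictOrderedRing R] [IsRealClosed R] [TopologicalSpace R] [OrderTopology R]
    [L.Structure R] [OMin.ExpandsOrderedField L R] [OMin.IsOMinimal L R]
    {n : ℕ} (X : OMin.DefSet L R n) :
    ∃ h : OMin.ClosedPoints (OMin.OMinSpectrum X) ≃ₜ MaximalSpectrum (OMin.definableContinuous X),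
      (∀ p, (h p).toPrimeSpectrum = OMin.iota X p.1) ∧
      ∃ (r : OMin.OMinSpectrum X → OMin.ClosedPoints (OMin.OMinSpectrum X))
        (rSpec : PrimeSpectrum (OMin.definableContinuous X) →
          MaximalSpectrum (OMin.definableContinuous X)),
        OMin.IsClosedPointRetraction Subtype.val r ∧
        OMin.IsClosedPointRetraction MaximalSpectrum.toPrimeSpectrum rSpec ∧
        ∀ p, h (r p) = rSpec (OMin.iota X p) := by
  let h := (Equiv.ofBijective _ (OMin.iotaClosed_bijective (X := X))).toHomeomorphOfIsInducing
    OMin.isInducing_iotaClosed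
  have hh : ∀ p, (h p).toPrimeSpectrum = OMin.iota X p.1 := fun _ => rfl
  obtain ⟨rSpec, hr⟩ := OMin.exists_isClosedPointRetraction_primeSpectrum
    (OMin.exists_mul_eq_zero_isCoprime (X := X))
  -- The commuting square dictates the retraction on types. Its properties follow because `iota`
  -- preserves and reflects the closure relation between points.
  refine ⟨h, hh, fun p => h.symm (rSpec (OMin.iota X p)), rSpec, ⟨?_, fun p => ?_, fun p m => ?_⟩,
    hr, fun p => h.apply_symm_apply _⟩
  · exact h.symm.continuous.comp (hr.continuous.comp OMin.isInducing_iota.continuous)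
  · rw [← hh, hr.leftInverse, h.symm_apply_apply]
  · rw [OMin.iota_mem_closure_iff, ← hh, hr.mem_closure_iff, h.eq_symm_apply]
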